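/- **Setting.** Let $K$ be a finite abstract simplicial complex of dimension at most $2$ with vertex set $K_0$, let $n\ge 1$, and let $f\colon K_0\to\mathbb Z^n$ be component-wise injective (each $f_i\colon K_0\to\mathbb Z$ is injective). Extend $f$ to all simplices by $f_i(\tau)=\max\{f_i(\sigma):\sigma\text{ a facet of }\tau\}$, i.e. by the component-wise maximum over the vertices. For $u\in\mathbb Z^n$ put $K^u=\{\sigma\in K: f(\sigma)\preceq u\}$, with $\preceq$ the component-wise order, and $K^{<u}=\bigcup_{i=1}^n K^{u-e_i}$, with $e_1,\dots,e_n$ the standard basis. Homology is with coefficients in $\mathbb Z/2$. **Discrete gradients.** A discrete vector field $V$ is a set of pairs $(\sigma,\tau)$ with $\sigma$ a facet of $\tau$ such that every simplex lies in at most one pair; simplices in no pair are critical. A $V$-path from $\sigma_0$ to $\sigma_r$ is a sequence $(\sigma_0,\tau_0,\sigma_1,\dots,\tau_{r-1},\sigma_r)$, $r\ge1$, with $(\sigma_i,\tau_i)\in V$ and $\sigma_{i+1}\ne\sigma_i$ a facet of $\tau_i$. $V$ is a discrete gradient vector field if no $V$-path has $\sigma_r=\sigma_0$. It is consistent with the filtration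 if for all $(\sigma,\tau)\in V$ and all $u$, $\sigma\in K^u\iff\tau\in K^u$. It is relative-perfect if for all $u\in\mathbb Z^n$ and $q\in\mathbb Z$ the number of critical $q$-simplices in $K^u\setminus K^{<u}$ equals $\dim H_q(K^u,K^{<u})$. The Morse complex has the critical simplices as cells; the incidence of $\tau$ and $\sigma$ is the parity of the number of separatrices from $\tau$ to $\sigma$, a separatrix being either the relation that $\sigma$ is a facet of $\tau$, or a facet of $\tau$ together with a $V$-path from it to $\sigma$. **HomotopyExpansion.** The lower star of $\sigma$ is $L_f(\sigma)=\{\tau\in K:\sigma\subseteq\tau,\ f(\tau)\preceq f(\sigma)\}$; $\sigma$ is primary if $L_f(\sigma)=f^{-1}(u)$ for some $u\in\mathbb Z^n$. The input of HomotopyExpansion is $L=L_f(\sigma)$ and an injective indexing by natural numbers of $L$ that strictly increases from a facet to a cofacet; the output is a set $V_\sigma$ of discrete vectors and a set $M_\sigma$ of unpaired cells. Write $U(\alpha)$ for the set of currently unclassified facets of $\alpha$ in $L$. If $L=\{\sigma\}$, the output is $V_\sigma=\emptyset$, $M_\sigma=\{\sigma\}$. Otherwise let $\delta$ be the cofacet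 of $\sigma$ in $L$ of minimal index, put $(\sigma,\delta)$ in $V_\sigma$, classify $\sigma$ and $\delta$, let the list Ord0 consist of all $\alpha\in L\setminus\{\sigma,\delta\}$ with $U(\alpha)=\emptyset$ and the list Ord1 of all cofacets $\alpha\in L\setminus\{\sigma\}$ of $\delta$ with $|U(\alpha)|=1$, and repeat until both lists are empty: * if Ord1 is non-empty, remove its first element $\alpha$. If $U(\alpha)=\emptyset$, append $\alpha$ to Ord0. Otherwise, for $\lambda\in U(\alpha)$, put $(\lambda,\alpha)$ in $V_\sigma$, remove $\lambda$ from Ord0, classify $\lambda$ and $\alpha$, and then append to Ord1 all $\beta\in L\setminus\{\sigma\}$ with $|U(\beta)|=1$ that are cofacets of $\alpha$ or of $\lambda$; * if Ord1 is empty, remove the first element $\gamma$ of Ord0, put it in $M_\sigma$, classify it, and append to Ord1 all cofacets $\beta\in L\setminus\{\sigma\}$ of $\gamma$ with $|U(\beta)|=1$. Simplices appended at the same time may be appended in any order. **Theorem 5.1.** There is a set $V$ of pairs of simplices of $K$ that is the union of the outputs $V_\sigma$ of terminating runs of HomotopyExpansion on the lower stars $L_f(\sigma)$ of all primary simplices $\sigma$.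 Every set $V$ obtained in this way (for any indexings and any orders of appending) is a discrete gradient vector field on $K$ that is consistent with $\{K^u\}_{u\in\mathbb Z^n}$ and relative-perfect. Moreover, for every $u\in\mathbb Z^n$ and every critical simplex $\tau\in K^u\setminus K^{<u}$, the boundary of $\tau$ in the Morse complex, relative to the critical simplices in $K^{<u}$, vanishes mod $2$. In particular, a relative-perfect discrete gradient vector field consistent with $\{K^u\}$ exists. -/

import Mathlib

noncomputable section

namespace MultiMorse

/-! ## Cell complexes with coefficients in the field with two elements -/

/-- A finite cell complex over `ZMod 2`, with set of cells `α`: a dimension and an incidence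
function `κ`, nonzero only between cells of consecutive dimensions, whose square vanishes. -/
structure CellComplex (α : Type*) [Fintype α] where
  dim : α → ℕ
  κ : α → α → ZMod 2
  dim_eq : ∀ t s, κ t s ≠ 0 → dim t = dim s + 1
  sum_eq_zero : ∀ t s, ∑ r, κ t r * κ r s = 0

/-- `s` is a facet of `t` (and `t` is a cofacet of `s`). -/
def CellComplex.IsFacet {α : Type*} [Fintype α] (X : CellComplex α) (s t : α) : Prop :=
  X.κ t s ≠ 0

section Chains

variable {α : Type*}

/-- The chains spanned by the cells of `S`. -/
def chains (S : Set α) : Submodule (ZMod 2) (α → ZMod 2) where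
  carrier := {c | ∀ a, a ∉ S → c a = 0}
  add_mem' := by
    intro x y hx hy a ha
    simp [hx a ha, hy a ha]
  zero_mem' := by
    intro a _
    rfl
  smul_mem' := by
    intro r x hx a ha
    simp [hx a ha]

variable [Fintype α]

/-- The boundary operator `∂ t = ∑ s, κ t s • s` of an incidence function, extended linearly. -/
def boundary (κ : α → α → ZMod 2) : (α → ZMod 2) →ₗ[ZMod 2] (α → ZMod 2) :=
  Fintype.linearCombination (ZMod 2) κ

/-- The `q`-cells in a set of cells. -/
def CellComplex.cellsOfDim (X : CellComplex α) (A : Set α) (q : ℤ) : Set α :=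
  {a | a ∈ A ∧ (X.dim a : ℤ) = q}

/-- Relative `q`-cycles of the pair `(A, B)`: `q`-chains of `A` whose boundary lies in `B`. -/
def CellComplex.relCycles (X : CellComplex α) (A B : Set α) (q : ℤ) :
    Submodule (ZMod 2) (α → ZMod 2) :=
  chains (X.cellsOfDim A q) ⊓ (chains B).comap (boundary X.κ)

/-- Relative `q`-boundaries of the pair `(A, B)`: boundaries of `(q+1)`-chains of `A`, modulo
`q`-chains of `B`. -/
def CellComplex.relBoundaries (X : CellComplex α) (A B : Set α) (q : ℤ) :
    Submodule (ZMod 2) (α → ZMod 2) :=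
  (chains (X.cellsOfDim A (q + 1))).map (boundary X.κ) ⊔ chains (X.cellsOfDim B q)

/-- The relative homology `H_q(A, B)` of subcomplexes `B ⊆ A`, i.e. the homology of the quotient
complex `C(A) / C(B)`, as relative cycles modulo relative boundaries. -/
abbrev CellComplex.RelHomology (X : CellComplex α) (A B : Set α) (q : ℤ) : Type _ :=
  X.relCycles A B q ⧸ (X.relBoundaries A B q).submoduleOf (X.relCycles A B q)

end Chains

/-! ## Discrete gradient vector fields and the Morse complex -/

section Gradient

variable {α : Type*} [Fintype α] (X : CellComplex α)

/-- A discrete vector field: a set of pairs (facet, cofacet) such that every cell belongs to at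
most one pair. -/
structure IsDiscreteVectorField (V : Set (α × α)) : Prop where
  facet : ∀ p ∈ V, X.IsFacet p.1 p.2
  tail_inj : ∀ p ∈ V, ∀ p' ∈ V, p.1 = p'.1 → p = p'
  head_inj : ∀ p ∈ V, ∀ p' ∈ V, p.2 = p'.2 → p = p'
  tail_ne_head : ∀ p ∈ V, ∀ p' ∈ V, p.1 ≠ p'.2

/-- `VPath X V s s'` is the type of `V`-paths `(s₀, t₀, s₁, …, t_{r-1}, s_r)`, `r ≥ 1`, from
`s₀ = s` to `s_r = s'`: each `(s_i, t_i)` is in `V`, and `s_{i+1} ≠ s_i` is a facet of `t_i`. -/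
inductive VPath (V : Set (α × α)) : α → α → Type _
  | single {s t s' : α} (h : (s, t) ∈ V) (hf : X.IsFacet s' t) (hne : s' ≠ s) : VPath V s s'
  | cons {s t s' s'' : α} (h : (s, t) ∈ V) (hf : X.IsFacet s' t) (hne : s' ≠ s)
      (p : VPath V s' s'') : VPath V s s''

/-- A discrete gradient vector field: a discrete vector field without closed `V`-paths. -/
def IsDiscreteGradient (V : Set (α × α)) : Prop :=
  IsDiscreteVectorField X V ∧ ∀ s, IsEmpty (VPath X V s s)

/-- A cell is critical if it belongs to no discrete vector. -/
def IsCritical (V : Set (α × α)) (c : α) : Prop :=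
  ∀ p ∈ V, p.1 ≠ c ∧ p.2 ≠ c

/-- The cells of the Morse complex: the critical cells. -/
abbrev MorseCell (V : Set (α × α)) : Type _ := {c : α // IsCritical V c}

instance (V : Set (α × α)) : Fintype (MorseCell V) := Fintype.ofFinite _

/-- A separatrix from `t` to `s`: either `s` is a facet of `t`, or a facet of `t` together with a
`V`-path from it to `s`. -/
abbrev Separatrix (V : Set (α × α)) (t s : α) : Type _ :=
  PLift (X.IsFacet s t) ⊕ (Σ r : {r : α // X.IsFacet r t}, VPath X V r.1 s)

/-- The incidence function of the Morse complex: the parity of the number of separatrices (there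
are finitely many of them if `V` is a discrete gradient vector field). -/
def morseIncidence (V : Set (α × α)) (t s : MorseCell V) : ZMod 2 :=
  (Nat.card (Separatrix X V t.1 s.1) : ZMod 2)

variable {X}

def VPath.append {V : Set (α × α)} {s : α} :
    ∀ {r t : α}, VPath X V r s → VPath X V s t → VPath X V r t
  | _, _, .single h hf hne, q => .cons h hf hne q
  | _, _, .cons h hf hne p, q => .cons h hf hne (p.append q)

theorem VPath.finite {V : Set (α × α)} (hV : IsDiscreteGradient X V) (s s' : α) :
    Finite (VPath X V s s') := by
  classical
  let R : α → α → Prop := fun a b => Nonempty (VPath X V b a)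
  have : IsTrans α R := ⟨fun a b c ⟨p⟩ ⟨q⟩ => ⟨q.append p⟩⟩
  have : Std.Irrefl R := ⟨fun a ⟨p⟩ => (hV.2 a).false p⟩
  have wf : WellFounded R := Finite.wellFounded_of_trans_of_irrefl R
  induction s using wf.induction with
  | _ s ih =>
    have hfin : ∀ z : {z : α × α // (s, z.1) ∈ V ∧ X.IsFacet z.2 z.1 ∧ z.2 ≠ s},
        Finite (VPath X V z.1.2 s') := fun z => ih _ ⟨.single z.2.1 z.2.2.1 z.2.2.2⟩
    let T := Σ z : {z : α × α // (s, z.1) ∈ V ∧ X.IsFacet z.2 z.1 ∧ z.2 ≠ s},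
      Option (VPath X V z.1.2 s')
    let g : VPath X V s s' → T := fun p => match p with
      | .single (t := t) h hf hne => ⟨⟨(t, s'), h, hf, hne⟩, none⟩
      | .cons (t := t) (s' := r) h hf hne p => ⟨⟨(t, r), h, hf, hne⟩, some p⟩
    refine Finite.of_injective g ?_
    intro p q hpq
    cases p <;> cases q <;> simp only [g, T, Sigma.mk.injEq, Subtype.mk.injEq, Prod.mk.injEq] at hpq
    · obtain ⟨⟨rfl, -⟩, -⟩ := hpq
      rfl
    · obtain ⟨⟨rfl, rfl⟩, h⟩ := hpq
      simp at h
    · obtain ⟨⟨rfl, rfl⟩, h⟩ := hpq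
      simp at h
    · obtain ⟨⟨rfl, rfl⟩, h⟩ := hpq
      simp at h
      subst h
      rfl

theorem Separatrix.finite {V : Set (α × α)} (hV : IsDiscreteGradient X V) (t s : α) :
    Finite (Separatrix X V t s) := by
  have : ∀ a b, Finite (VPath X V a b) := VPath.finite hV
  infer_instance

end Gradient

/-! ## Multi-filtrations, consistency and relative-perfectness -/

section Filtration

variable {α : Type*} {n : ℕ}

/-- The union of the `F (u - e_i)`, `1 ≤ i ≤ n`. -/
def previous (F : (Fin n → ℤ) → Set α) (u : Fin n → ℤ) : Set α :=
  ⋃ i : Fin n, F (u - Pi.single i 1)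

/-- A discrete vector field is consistent with a filtration if the two cells of each vector enter
it at the same grades. -/
def IsConsistent (V : Set (α × α)) (F : (Fin n → ℤ) → Set α) : Prop :=
  ∀ p ∈ V, ∀ u, p.1 ∈ F u ↔ p.2 ∈ F u

variable [Fintype α] (X : CellComplex α)

/-- The Morse number `m_q(u)`. -/
def morseNumber (V : Set (α × α)) (F : (Fin n → ℤ) → Set α) (q : ℤ) (u : Fin n → ℤ) : ℕ :=
  {c : α | IsCritical V c ∧ (X.dim c : ℤ) = q ∧ c ∈ F u ∧ c ∉ previous F u}.ncard

/-- Relative-perfectness: `m_q(u) = dim H_q(K^u, ⋃_i K^{u - e_i})` for all `q` and `u`. -/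
def IsRelativePerfect (V : Set (α × α)) (F : (Fin n → ℤ) → Set α) : Prop :=
  ∀ (q : ℤ) (u : Fin n → ℤ),
    morseNumber X V F q u = Module.finrank (ZMod 2) (X.RelHomology (F u) (previous F u) q)

/-- The relative boundary of each critical cell `t` in `M^u` but not in `⋃_i M^{u - e_i}` vanishes:
the boundary of `t` in the Morse complex is zero modulo the chains of `⋃_i M^{u - e_i}`. -/
def MorseRelBoundaryVanishes (V : Set (α × α)) (F : (Fin n → ℤ) → Set α) : Prop :=
  open Classical in
  ∀ (u : Fin n → ℤ) (t : MorseCell V), t.1 ∈ F u → t.1 ∉ previous F u →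
    boundary (morseIncidence X V) (Pi.single t 1) ∈
      chains {s : MorseCell V | s.1 ∈ previous F u}

end Filtration

/-! ## The algorithm `HomotopyExpansion` -/

section Algorithm

variable {α : Type*}

/-- The variables of the algorithm: the two ordered lists, the set of classified cells, and the two
output sets (discrete vectors, unpaired cells). -/
structure HEState (α : Type*) where
  ord0 : List α
  ord1 : List α
  classified : Set α
  vectors : Set (α × α)
  unpaired : Set α

/-- The list `l` enumerates the set `S` without repetitions, in some order. -/
def Enumerates (l : List α) (S : Set α) : Prop :=
  l.Nodup ∧ ∀ a, a ∈ l ↔ a ∈ S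

variable [Fintype α] (X : CellComplex α)

/-- The unclassified facets of `a` in `L`, for a given set `C` of classified cells. -/
def unclassFacets (L : Set α) (C : Set α) (a : α) : Set α :=
  {l | l ∈ L ∧ X.IsFacet l a ∧ l ∉ C}

open Classical in
/-- One pass through the loops of the algorithm on the set `L` with distinguished cell `σ`.
The order in which several cells are appended at once is arbitrary. -/
inductive HEStep (L : Set α) (σ : α) : HEState α → HEState α → Prop
  /-- The first element of `Ord1` has no unclassified facets left: it is moved to `Ord0`. -/
  | defer (S : HEState α) (a : α) (rest : List α) (h : S.ord1 = a :: rest)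
      (hU : (unclassFacets X L S.classified a).ncard = 0) :
      HEStep L σ S { S with ord1 := rest, ord0 := S.ord0 ++ [a] }
  /-- The first element `a` of `Ord1` is paired with its unclassified facet. -/
  | pair (S : HEState α) (a : α) (rest : List α) (h : S.ord1 = a :: rest)
      (U : Set α) (hU : U = unclassFacets X L S.classified a) (hU' : U.ncard ≠ 0)
      (C : Set α) (hC : C = S.classified ∪ {a} ∪ U) (new : List α)
      (hnew : Enumerates new {b | b ∈ L ∧ b ≠ σ ∧ (unclassFacets X L C b).ncard = 1 ∧
        (X.IsFacet a b ∨ ∃ l ∈ U, X.IsFacet l b)}) :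
      HEStep L σ S
        { ord0 := S.ord0.filter (fun x => x ∉ U)
          ord1 := rest ++ new
          classified := C
          vectors := S.vectors ∪ {p | p.1 ∈ U ∧ p.2 = a}
          unpaired := S.unpaired }
  /-- `Ord1` is empty: the first element `c` of `Ord0` is classified as unpaired. -/
  | critical (S : HEState α) (c : α) (rest : List α) (h1 : S.ord1 = []) (h0 : S.ord0 = c :: rest)
      (C : Set α) (hC : C = S.classified ∪ {c}) (new : List α)
      (hnew : Enumerates new {b | b ∈ L ∧ b ≠ σ ∧ (unclassFacets X L C b).ncard = 1 ∧
        X.IsFacet c b}) :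
      HEStep L σ S
        { ord0 := rest
          ord1 := new
          classified := C
          vectors := S.vectors
          unpaired := S.unpaired ∪ {c} }

/-- An indexing of the cells of `L` compatible with the facet relation. -/
structure IsIndexing (L : Set α) (I : α → ℕ) : Prop where
  injOn : Set.InjOn I L
  lt_of_facet : ∀ a ∈ L, ∀ b ∈ L, X.IsFacet a b → I a < I b

/-- `HomotopyExpansion X L σ I V M`: the algorithm, run on the set `L` with distinguished cell `σ`
and indexing `I`, can terminate with the set `V` of discrete vectors and the set `M` of unpaired
cells. -/
inductive HomotopyExpansion (L : Set α) (σ : α) (I : α → ℕ) : Set (α × α) → Set α → Prop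
  | trivial (hL : L = {σ}) : HomotopyExpansion L σ I ∅ {σ}
  | expand (hL : L ≠ {σ}) (δ : α) (hδ : δ ∈ L) (hσδ : X.IsFacet σ δ)
      (hmin : ∀ δ' ∈ L, X.IsFacet σ δ' → I δ ≤ I δ')
      (ord0 ord1 : List α)
      (h0 : Enumerates ord0 {a | a ∈ L ∧ a ≠ σ ∧ a ≠ δ ∧ (unclassFacets X L {σ, δ} a).ncard = 0})
      (h1 : Enumerates ord1 {a | a ∈ L ∧ a ≠ σ ∧ (unclassFacets X L {σ, δ} a).ncard = 1 ∧
        X.IsFacet δ a})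
      (S : HEState α)
      (hrun : Relation.ReflTransGen (HEStep X L σ)
        { ord0 := ord0, ord1 := ord1, classified := {σ, δ}, vectors := {(σ, δ)}, unpaired := ∅ } S)
      (hend0 : S.ord0 = []) (hend1 : S.ord1 = []) :
      HomotopyExpansion L σ I S.vectors S.unpaired

end Algorithm

/-! ## Simplicial complexes filtered by a function on the vertices -/

section Simplicial

variable {ι : Type*} (K : AbstractSimplicialComplex ι)

/-- The simplices of `K`. -/
abbrev Simplex : Type _ := {s : Finset ι // s ∈ K.faces}

variable {K} in
theorem Simplex.nonempty (s : Simplex K) : s.1.Nonempty :=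
  (K.isRelLowerSet_faces s.2).1

/-- The extension of a function on the vertices to all simplices by the componentwise maximum. -/
def extend {n : ℕ} (f : ι → Fin n → ℤ) (s : Simplex K) : Fin n → ℤ :=
  fun i => s.1.sup' s.nonempty (fun v => f v i)

/-- The sublevel set `K^u`. -/
def sublevel {n : ℕ} (f : ι → Fin n → ℤ) (u : Fin n → ℤ) : Set (Simplex K) :=
  {s | extend K f s ≤ u}

/-- The lower star of a simplex. -/
def lowerStar {n : ℕ} (f : ι → Fin n → ℤ) (s : Simplex K) : Set (Simplex K) :=
  {t | s.1 ⊆ t.1 ∧ extend K f t ≤ extend K f s}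

/-- A simplex is primary if its lower star is a whole level set of the extended function. -/
def IsPrimary {n : ℕ} (f : ι → Fin n → ℤ) (s : Simplex K) : Prop :=
  ∃ u : Fin n → ℤ, lowerStar K f s = {t | extend K f t = u}

variable [Finite ι]

instance : Fintype (Simplex K) := Fintype.ofFinite _

open Classical in
/-- The cell complex, with coefficients mod 2, of a finite simplicial complex. -/
def simplicialCellComplex : CellComplex (Simplex K) where
  dim s := s.1.card - 1
  κ t s := if s.1 ⊆ t.1 ∧ t.1.card = s.1.card + 1 then 1 else 0
  dim_eq := by
    intro t s h
    have h' : s.1 ⊆ t.1 ∧ t.1.card = s.1.card + 1 := by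
      by_contra hc
      exact h (if_neg hc)
    have := s.nonempty.card_pos
    omega
  sum_eq_zero := by
    intro t s
    simp only [mul_ite, mul_one, mul_zero, ← ite_and]
    rw [Finset.sum_boole]
    set T : Finset (Simplex K) := Finset.univ.filter (fun r : Simplex K =>
      (s.1 ⊆ r.1 ∧ r.1.card = s.1.card + 1) ∧ (r.1 ⊆ t.1 ∧ t.1.card = r.1.card + 1)) with hT
    by_cases h : s.1 ⊆ t.1 ∧ t.1.card = s.1.card + 2
    · have hc : T.card = (t.1 \ s.1).card := by
        symm
        refine Finset.card_bij (fun v hv => ⟨insert v s.1,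
          (K.isRelLowerSet_faces t.2).2 (Finset.insert_subset (Finset.mem_sdiff.1 hv).1 h.1)
            (Finset.insert_nonempty _ _)⟩) ?_ ?_ ?_
        · intro v hv
          have hv' := Finset.mem_sdiff.1 hv
          have := Finset.card_insert_of_notMem hv'.2
          simp only [hT, Finset.mem_filter, Finset.mem_univ, true_and]
          refine ⟨⟨Finset.subset_insert _ _, this⟩, Finset.insert_subset hv'.1 h.1, ?_⟩
          omega
        · intro v hv w hw hvw
          have hv' := Finset.mem_sdiff.1 hv
          have hvw' : insert v s.1 = insert w s.1 := congrArg Subtype.val hvw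
          have : v ∈ insert w s.1 := hvw' ▸ Finset.mem_insert_self v s.1
          rcases Finset.mem_insert.1 this with h1 | h1
          · exact h1
          · exact absurd h1 hv'.2
        · intro r hr
          simp only [hT, Finset.mem_filter, Finset.mem_univ, true_and] at hr
          obtain ⟨v, hv, hr'⟩ := (Finset.covBy_iff_exists_insert (s := s.1) (t := r.1)).1
            (Finset.covBy_iff_card_sdiff_eq_one.2 ⟨hr.1.1, by
              rw [Finset.card_sdiff_of_subset hr.1.1]
              omega⟩)
          refine ⟨v, Finset.mem_sdiff.2 ⟨hr.2.1 (hr' ▸ Finset.mem_insert_self v s.1), hv⟩, ?_⟩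
          exact Subtype.ext hr'
      rw [hc, Finset.card_sdiff_of_subset h.1, h.2, Nat.add_sub_cancel_left]
      exact CharP.cast_eq_zero (ZMod 2) 2
    · have : T = ∅ := by
        rw [hT, Finset.filter_eq_empty_iff]
        rintro r - ⟨⟨h1, h2⟩, h3, h4⟩
        exact h ⟨h1.trans h3, by omega⟩
      simp [this]

theorem simplicialCellComplex_isFacet_iff (s t : Simplex K) :
    (simplicialCellComplex K).IsFacet s t ↔ s.1 ⊆ t.1 ∧ t.1.card = s.1.card + 1 := by
  simp [CellComplex.IsFacet, simplicialCellComplex]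

/-- In positive dimension, each component of the extended function on a simplex is the maximum of
its values on the facets. -/
theorem extend_isGreatest {n : ℕ} (f : ι → Fin n → ℤ) (t : Simplex K) (ht : 2 ≤ t.1.card)
    (i : Fin n) :
    IsGreatest {x | ∃ s, (simplicialCellComplex K).IsFacet s t ∧ x = extend K f s i}
      (extend K f t i) := by
  classical
  constructor
  · obtain ⟨v, hv, hmax⟩ := Finset.exists_mem_eq_sup' t.nonempty (fun v => f v i)
    obtain ⟨w, hw, hwv⟩ := Finset.exists_mem_ne (by omega : 1 < t.1.card) v
    have hve : v ∈ t.1.erase w := Finset.mem_erase.2 ⟨hwv.symm, hv⟩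
    refine ⟨⟨t.1.erase w, (K.isRelLowerSet_faces t.2).2 (Finset.erase_subset _ _) ⟨v, hve⟩⟩, ?_, ?_⟩
    · rw [simplicialCellComplex_isFacet_iff]
      refine ⟨Finset.erase_subset _ _, ?_⟩
      have := Finset.card_erase_add_one hw
      exact this.symm
    · apply le_antisymm
      · change t.1.sup' _ _ ≤ _
        rw [hmax]
        exact Finset.le_sup' (fun v => f v i) hve
      · exact Finset.sup'_mono _ (Finset.erase_subset _ _) _
  · rintro x ⟨s, hs, rfl⟩
    exact Finset.sup'_mono _ ((simplicialCellComplex_isFacet_iff K s t).1 hs).1 _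

/-- `V` is the union of the discrete vectors produced by runs of the algorithm on the lower stars
of all primary simplices, for some indexing of each of these lower stars. -/
def IsHomotopyExpansionField {n : ℕ} (f : ι → Fin n → ℤ) (V : Set (Simplex K × Simplex K)) : Prop :=
  ∃ (I : Simplex K → Simplex K → ℕ) (W : Simplex K → Set (Simplex K × Simplex K))
    (M : Simplex K → Set (Simplex K)),
    (∀ s, IsPrimary K f s → IsIndexing (simplicialCellComplex K) (lowerStar K f s) (I s) ∧
      HomotopyExpansion (simplicialCellComplex K) (lowerStar K f s) s (I s) (W s) (M s)) ∧
    V = ⋃ s ∈ {s | IsPrimary K f s}, W s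

end Simplicial

end MultiMorse

end

/-! The problem splits along grades. Since each `f i` is injective, the vertices of a simplex at
which some coordinate of its grade is attained depend only on that grade. They span the unique
primary simplex of the grade, whose lower star is the whole level set, that is `K^u` minus `K^{<u}`
(`exists_isPrimary`, `sublevel_sdiff_previous`).

In dimension at most two, such a lower star is essentially a graph (`isShortStar_lowerStar`): the
center `σ` plays the empty simplex, its cofacets are the vertices, and the remaining outer cells are
edges, each with two endpoints. The algorithm is a search of this graph. It pairs `σ` with the first
vertex and each tree edge with the vertex it discovers. Edges that close a cycle and the roots of
further components stay unpaired. `HEInvariant` records this: every treated edge has its boundary in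
the span of the boundaries of tree edges, and discovery order gives a height that excludes cycles.
At the end, the boundaries of the heads span all boundaries in the level set, dimension by dimension
(`IsPerfectMatching`).

Both remaining claims follow by linear algebra. By the height, the head boundaries are triangular,
hence independent, so heads count the ranks of the relative boundary maps and unpaired cells count
homology (`IsPerfectMatching.ncard_critical`). For a critical `s`, the parity of `V`-paths to `s` is
a linear functional that kills the boundary of every head, since the paths from its tail are those
through its other facets. Hence it kills every boundary in the level set, which makes the relative
Morse boundary zero (`IsPerfectMatching.sum_pathParity`). -/

noncomputable section

namespace MultiMorse

/-! ### Boundaries restricted to a level set, and perfect matchings -/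

section RestrictedBoundary

variable {α : Type*}

/-- The restriction of chains to the cells of `L`. -/
def restrictChain (L : Set α) : (α → ZMod 2) →ₗ[ZMod 2] (α → ZMod 2) where
  toFun c := L.indicator c
  map_add' := fun c d => Set.indicator_add L c d
  map_smul' := fun r c => Set.indicator_const_smul L r c

theorem restrictChain_apply (L : Set α) (c : α → ZMod 2) : restrictChain L c = L.indicator c := rfl

theorem zmod_two_eq_one {a : ZMod 2} (h : a ≠ 0) : a = 1 := by
  revert a
  decide

theorem chain_add_self (c : α → ZMod 2) : c + c = 0 := by
  funext a
  exact CharTwo.add_self_eq_zero (c a)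

variable [Fintype α] (X : CellComplex α)

/-- The part in `L` of the boundary of a cell. -/
def cellBoundary (L : Set α) (x : α) : α → ZMod 2 :=
  restrictChain L (X.κ x)

variable {X} in
theorem CellComplex.κ_eq_one_iff {t s : α} : X.κ t s = 1 ↔ X.IsFacet s t :=
  ⟨fun h => by simp [CellComplex.IsFacet, h], zmod_two_eq_one⟩

theorem CellComplex.κ_eq_zero {t s : α} (h : ¬X.IsFacet s t) : X.κ t s = 0 :=
  not_not.1 h

/-- A matching `W` of the cells of `L` that is acyclic, as witnessed by a height function on the
tails, and whose heads span the relative boundaries in each dimension. -/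
structure IsPerfectMatching (L : Set α) (W : Set (α × α)) : Prop where
  isDiscreteVectorField : IsDiscreteVectorField X W
  tail_mem : ∀ p ∈ W, p.1 ∈ L
  head_mem : ∀ p ∈ W, p.2 ∈ L
  exists_height : ∃ T : α → ℕ, ∀ p ∈ W, ∀ l ∈ L, X.IsFacet l p.2 → l ≠ p.1 → T l < T p.1
  boundary_mem : ∀ x ∈ L, cellBoundary X L x ∈
    Submodule.span (ZMod 2) {c | ∃ p ∈ W, X.dim p.2 = X.dim x ∧ c = cellBoundary X L p.2}

theorem IsDiscreteVectorField.empty : IsDiscreteVectorField X ∅ :=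
  ⟨by simp, by simp, by simp, by simp⟩

theorem IsPerfectMatching.empty : IsPerfectMatching X ∅ ∅ where
  isDiscreteVectorField := .empty X
  tail_mem := by simp
  head_mem := by simp
  exists_height := ⟨0, by simp⟩
  boundary_mem := by simp

end RestrictedBoundary

/-! ### Short stars and the search performed by the algorithm -/

section ShortStar

variable {α : Type*} [Fintype α] (X : CellComplex α)

/-- A set of cells that consists of a cell `σ`, of cells with `σ` as their only facet in `L`, and
of cells with exactly two facets in `L`, both of them cofacets of `σ`. -/
structure IsShortStar (L : Set α) (σ : α) : Prop where
  mem : σ ∈ L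
  not_isFacet : ∀ l ∈ L, ¬X.IsFacet l σ
  eq_of_isFacet : ∀ a, X.IsFacet σ a → ∀ l ∈ L, X.IsFacet l a → l = σ
  exists_facets : ∀ a ∈ L, a ≠ σ → ¬X.IsFacet σ a → ∃ x y, x ∈ L ∧ y ∈ L ∧ x ≠ y ∧
    X.IsFacet σ x ∧ X.IsFacet σ y ∧ X.IsFacet x a ∧ X.IsFacet y a ∧
    ∀ l ∈ L, X.IsFacet l a → l = x ∨ l = y

/-- The cells of a short star at distance two from its center. -/
def outerCells (L : Set α) (σ : α) : Set α :=
  {a | a ∈ L ∧ a ≠ σ ∧ ¬X.IsFacet σ a}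

variable {X} {L : Set α} {σ : α}

namespace IsShortStar

theorem ne_center (h : IsShortStar X L σ) {a : α} (ha : X.IsFacet σ a) : a ≠ σ := by
  rintro rfl
  exact h.not_isFacet _ h.mem ha

/-- A short star has only three layers: facets inside `L` are either `σ` or cofacets of `σ`, so
nothing lies above an outer cell. -/
theorem not_isFacet_outer (h : IsShortStar X L σ) {a b : α} (ha : a ∈ outerCells X L σ)
    (hb : b ∈ L) : ¬X.IsFacet a b := by
  intro hab
  by_cases hbσ : b = σ
  · exact h.not_isFacet a ha.1 (hbσ ▸ hab)
  by_cases hσb : X.IsFacet σ b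
  · exact ha.2.1 (h.eq_of_isFacet b hσb a ha.1 hab)
  · obtain ⟨x, y, -, -, -, hx, hy, -, -, hxy⟩ := h.exists_facets b hb hbσ hσb
    rcases hxy a ha.1 hab with rfl | rfl
    · exact ha.2.2 hx
    · exact ha.2.2 hy

/-- The other facet of an outer cell. -/
theorem exists_other (h : IsShortStar X L σ) {a x : α} (ha : a ∈ outerCells X L σ) (hx : x ∈ L)
    (hxa : X.IsFacet x a) : ∃ y ∈ L, x ≠ y ∧ X.IsFacet σ x ∧ X.IsFacet σ y ∧ X.IsFacet y a ∧
      ∀ l ∈ L, X.IsFacet l a → l = x ∨ l = y := by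
  obtain ⟨x', y', hx', hy', hne, hσx, hσy, hxa', hya', hall⟩ :=
    h.exists_facets a ha.1 ha.2.1 ha.2.2
  rcases hall x hx hxa with rfl | rfl
  · exact ⟨y', hy', hne, hσx, hσy, hya', hall⟩
  · exact ⟨x', hx', hne.symm, hσy, hσx, hxa', fun l hl hla => (hall l hl hla).symm⟩

theorem cellBoundary_center (h : IsShortStar X L σ) : cellBoundary X L σ = 0 := by
  funext s
  rw [cellBoundary, restrictChain_apply]
  by_cases hs : s ∈ L
  · rw [Set.indicator_of_mem hs, X.κ_eq_zero (h.not_isFacet s hs)]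
    rfl
  · rw [Set.indicator_of_notMem hs]
    rfl

open Classical in
theorem cellBoundary_inner (h : IsShortStar X L σ) {a : α} (ha : X.IsFacet σ a) :
    cellBoundary X L a = Pi.single σ 1 := by
  funext s
  rw [cellBoundary, restrictChain_apply]
  by_cases hs : s = σ
  · subst hs
    rw [Set.indicator_of_mem h.mem, Pi.single_eq_same, CellComplex.κ_eq_one_iff]
    exact ha
  · rw [Pi.single_eq_of_ne hs]
    refine Set.indicator_apply_eq_zero.2 fun hsL => X.κ_eq_zero fun hsa => hs ?_
    exact h.eq_of_isFacet a ha s hsL hsa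

open Classical in
theorem cellBoundary_outer {a x y : α} (hx : x ∈ L) (hy : y ∈ L)
    (hne : x ≠ y) (hxa : X.IsFacet x a) (hya : X.IsFacet y a)
    (hall : ∀ l ∈ L, X.IsFacet l a → l = x ∨ l = y) :
    cellBoundary X L a = Pi.single x 1 + Pi.single y 1 := by
  funext s
  rw [cellBoundary, restrictChain_apply, Pi.add_apply]
  by_cases hsx : s = x
  · subst hsx
    rw [Set.indicator_of_mem hx, Pi.single_eq_same, Pi.single_eq_of_ne hne, add_zero,
      CellComplex.κ_eq_one_iff]
    exact hxa
  by_cases hsy : s = y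
  · subst hsy
    rw [Set.indicator_of_mem hy, Pi.single_eq_same, Pi.single_eq_of_ne hsx, zero_add,
      CellComplex.κ_eq_one_iff]
    exact hya
  · rw [Pi.single_eq_of_ne hsx, Pi.single_eq_of_ne hsy, add_zero]
    refine Set.indicator_apply_eq_zero.2 fun hsL => X.κ_eq_zero fun hsa => ?_
    rcases hall s hsL hsa with h | h <;> contradiction

theorem dim_outer (h : IsShortStar X L σ) {a : α} (ha : a ∈ outerCells X L σ) :
    X.dim a = X.dim σ + 2 := by
  obtain ⟨x, y, -, -, -, hx, -, hxa, -⟩ := h.exists_facets a ha.1 ha.2.1 ha.2.2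
  rw [X.dim_eq a x hxa, X.dim_eq x σ hx]

end IsShortStar

theorem unclassFacets_ncard_eq_zero {C : Set α} {a : α}
    (h : (unclassFacets X L C a).ncard = 0) {l : α} (hl : l ∈ L) (hla : X.IsFacet l a) : l ∈ C := by
  by_contra hlC
  have h' := (Set.ncard_eq_zero (Set.toFinite _)).1 h
  have : l ∈ unclassFacets X L C a := ⟨hl, hla, hlC⟩
  rw [h'] at this
  exact this

theorem exists_of_unclassFacets_ncard {C : Set α} {a : α}
    (h : (unclassFacets X L C a).ncard ≠ 0) : ∃ l ∈ L, X.IsFacet l a ∧ l ∉ C :=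
  Set.nonempty_of_ncard_ne_zero h

theorem unclassFacets_eq_singleton {C : Set α} {a x y : α}
    (hy : y ∈ L) (hya : X.IsFacet y a) (hyC : y ∉ C) (hxC : x ∈ C)
    (hall : ∀ l ∈ L, X.IsFacet l a → l = x ∨ l = y) : unclassFacets X L C a = {y} := by
  ext l
  constructor
  · rintro ⟨hl, hla, hlC⟩
    rcases hall l hl hla with rfl | rfl
    · exact absurd hxC hlC
    · rfl
  · rintro rfl
    exact ⟨hy, hya, hyC⟩

variable (X L σ) in
/-- The span of the boundaries of the heads in `V` that are outer cells. -/
def outerSpan (V : Set (α × α)) : Submodule (ZMod 2) (α → ZMod 2) :=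
  Submodule.span (ZMod 2) {c | ∃ p ∈ V, p.2 ∈ outerCells X L σ ∧ c = cellBoundary X L p.2}

theorem outerSpan_mono {V V' : Set (α × α)} (h : V ⊆ V') :
    outerSpan X L σ V ≤ outerSpan X L σ V' :=
  Submodule.span_mono fun _ ⟨p, hp, hp'⟩ => ⟨p, h hp, hp'⟩

open Classical in
variable (X L σ) in
/-- The invariant of the algorithm on a short star. -/
structure HEInvariant (S : HEState α) : Prop where
  classified_subset : S.classified ⊆ L
  center_mem : σ ∈ S.classified
  closed : ∀ a ∈ S.classified, ∀ l ∈ L, X.IsFacet l a → l ∈ S.classified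
  vectors_mem : ∀ p ∈ S.vectors, p.1 ∈ S.classified ∧ p.2 ∈ S.classified
  isDiscreteVectorField : IsDiscreteVectorField X S.vectors
  exists_center : ∃ δ, (σ, δ) ∈ S.vectors
  exists_height : ∃ (T : α → ℕ) (N : ℕ), (∀ x ∈ S.classified, T x < N) ∧
    ∀ p ∈ S.vectors, ∀ l ∈ L, X.IsFacet l p.2 → l ≠ p.1 → T l < T p.1
  ord0_nodup : S.ord0.Nodup
  ord1_nodup : S.ord1.Nodup
  ord0_mem : ∀ a ∈ S.ord0, a ∈ L ∧ a ∉ S.classified ∧ ∀ l ∈ L, X.IsFacet l a → l ∈ S.classified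
  ord1_mem : ∀ a ∈ S.ord1, a ∈ outerCells X L σ ∧ a ∉ S.classified ∧
    ∃ x ∈ S.classified, X.IsFacet x a
  disjoint : ∀ a ∈ S.ord1, a ∉ S.ord0
  -- Once both lists are empty, this propagates classification from `σ` to its cofacets and then to
  -- the outer cells.
  cover : ∀ a ∈ L, a ∉ S.classified →
    a ∈ S.ord0 ∨ a ∈ S.ord1 ∨ ∀ x ∈ L, X.IsFacet x a → x ∉ S.classified
  boundary_mem : ∀ a ∈ outerCells X L σ, a ∈ S.classified ∨ a ∈ S.ord0 →
    cellBoundary X L a ∈ outerSpan X L σ S.vectors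
  -- All edges waiting in `ord1` hang on one component of the graph. The chain `ρ` is its root, and
  -- membership in the span says that `x` is joined to the root by tree edges.
  exists_root : ∃ ρ : α → ZMod 2, ∀ a ∈ S.ord1, ∀ x ∈ S.classified, X.IsFacet x a →
    Pi.single x 1 + ρ ∈ outerSpan X L σ S.vectors

/-- The search starts at the root `δ`. An outer cell has two distinct endpoints, so none is yet
classified or in `ord0`, and the condition on boundaries is vacuous. -/
theorem HEInvariant.initial (hL : IsShortStar X L σ) {δ : α} (hδ : δ ∈ L) (hσδ : X.IsFacet σ δ)
    {ord0 ord1 : List α}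
    (h0 : Enumerates ord0 {a | a ∈ L ∧ a ≠ σ ∧ a ≠ δ ∧ (unclassFacets X L {σ, δ} a).ncard = 0})
    (h1 : Enumerates ord1 {a | a ∈ L ∧ a ≠ σ ∧ (unclassFacets X L {σ, δ} a).ncard = 1 ∧
      X.IsFacet δ a}) :
    HEInvariant X L σ { ord0 := ord0, ord1 := ord1, classified := {σ, δ}, vectors := {(σ, δ)}
                        unpaired := ∅ } := by
  have hδσ := hL.ne_center hσδ
  have hout : ∀ a ∈ ord1, a ∈ outerCells X L σ := by
    intro a ha
    obtain ⟨haL, haσ, -, hδa⟩ := (h1.2 a).1 ha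
    exact ⟨haL, haσ, fun h => hδσ (hL.eq_of_isFacet a h δ hδ hδa)⟩
  have hδout : δ ∉ outerCells X L σ := fun h => h.2.2 hσδ
  have hcl : ∀ a ∈ outerCells X L σ, a ∉ ({σ, δ} : Set α) := by
    rintro a ha (rfl | rfl)
    · exact ha.2.1 rfl
    · exact hδout ha
  constructor
  · rintro a (rfl | rfl)
    · exact hL.mem
    · exact hδ
  · exact Or.inl rfl
  · rintro a (rfl | rfl) l hl hla
    · exact absurd hla (hL.not_isFacet l hl)
    · exact Or.inl (hL.eq_of_isFacet a hσδ l hl hla)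
  · rintro p rfl
    exact ⟨Or.inl rfl, Or.inr rfl⟩
  · refine ⟨?_, ?_, ?_, ?_⟩
    · rintro p rfl
      exact hσδ
    · rintro p rfl p' rfl -
      rfl
    · rintro p rfl p' rfl -
      rfl
    · rintro p rfl p' rfl
      exact hδσ.symm
  · exact ⟨δ, rfl⟩
  · refine ⟨0, 1, by simp, ?_⟩
    rintro p rfl l hl hlδ hne
    exact absurd (hL.eq_of_isFacet δ hσδ l hl hlδ) hne
  · exact h0.1
  · exact h1.1
  · intro a ha
    obtain ⟨haL, haσ, haδ, hU⟩ := (h0.2 a).1 ha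
    refine ⟨haL, ?_, fun l hl hla => unclassFacets_ncard_eq_zero hU hl hla⟩
    rintro (h | h) <;> contradiction
  · intro a ha
    exact ⟨hout a ha, hcl a (hout a ha), δ, Or.inr rfl, ((h1.2 a).1 ha).2.2.2⟩
  · intro a ha ha'
    have e0 := ((h0.2 a).1 ha').2.2.2
    have e1 := ((h1.2 a).1 ha).2.2.1
    omega
  · intro a ha haC
    have haσ : a ≠ σ := fun h => haC (Or.inl h)
    have haδ : a ≠ δ := fun h => haC (Or.inr h)
    by_cases hσa : X.IsFacet σ a
    · refine Or.inl ((h0.2 a).2 ⟨ha, haσ, haδ, ?_⟩)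
      rw [Set.ncard_eq_zero]
      refine Set.eq_empty_of_forall_notMem ?_
      rintro l ⟨hl, hla, hlC⟩
      exact hlC (Or.inl (hL.eq_of_isFacet a hσa l hl hla))
    · refine Or.inr ?_
      by_cases hδa : X.IsFacet δ a
      · obtain ⟨y, hy, hne, -, hσy, hya, hall⟩ := hL.exists_other ⟨ha, haσ, hσa⟩ hδ hδa
        refine Or.inl ((h1.2 a).2 ⟨ha, haσ, ?_, hδa⟩)
        rw [unclassFacets_eq_singleton hy hya ?_ (Or.inr rfl) hall, Set.ncard_singleton]
        rintro (h | h)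
        · exact hL.ne_center hσy h
        · exact hne h.symm
      · refine Or.inr ?_
        rintro x - hxa (rfl | rfl) <;> contradiction
  · rintro a ha (h | h)
    · exact absurd h (hcl a ha)
    · obtain ⟨x, y, hx, hy, hne, hσx, hσy, hxa, hya, -⟩ := hL.exists_facets a ha.1 ha.2.1 ha.2.2
      have hU := ((h0.2 a).1 h).2.2.2
      have h1 := (unclassFacets_ncard_eq_zero hU hx hxa).resolve_left (hL.ne_center hσx)
      have h2 := (unclassFacets_ncard_eq_zero hU hy hya).resolve_left (hL.ne_center hσy)
      exact absurd (h1.trans h2.symm) hne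
  · classical
    refine ⟨Pi.single δ 1, ?_⟩
    rintro a ha x (rfl | rfl) hxa
    · exact absurd hxa (hout a ha).2.2
    · rw [chain_add_self]
      exact zero_mem _

/-- A deferred edge closes a cycle: both endpoints are joined to the same root, and in the sum of
the two relations `ρ` cancels mod 2, leaving the boundary of the edge. -/
theorem HEInvariant.defer (hL : IsShortStar X L σ) {S : HEState α} (hS : HEInvariant X L σ S)
    {a : α} {rest : List α} (h : S.ord1 = a :: rest)
    (hU : (unclassFacets X L S.classified a).ncard = 0) :
    HEInvariant X L σ { S with ord1 := rest, ord0 := S.ord0 ++ [a] } := by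
  classical
  have ha1 : a ∈ S.ord1 := h ▸ List.mem_cons_self
  have hrest : ∀ b ∈ rest, b ∈ S.ord1 := fun b hb => h ▸ List.mem_cons_of_mem a hb
  have hnd := hS.ord1_nodup
  rw [h, List.nodup_cons] at hnd
  obtain ⟨haout, haC, -⟩ := hS.ord1_mem a ha1
  obtain ⟨ρ, hρ⟩ := hS.exists_root
  refine { hS with
    ord0_nodup := ?_, ord1_nodup := hnd.2, ord0_mem := ?_
    ord1_mem := fun b hb => hS.ord1_mem b (hrest b hb), disjoint := ?_, cover := ?_
    boundary_mem := ?_, exists_root := ⟨ρ, fun b hb => hρ b (hrest b hb)⟩ }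
  · rw [List.nodup_append]
    refine ⟨hS.ord0_nodup, List.nodup_singleton a, ?_⟩
    intro b hb c hc
    rw [List.mem_singleton] at hc
    rintro rfl
    exact hS.disjoint a ha1 (hc ▸ hb)
  · intro b hb
    rcases List.mem_append.1 hb with hb | hb
    · exact hS.ord0_mem b hb
    · rw [List.mem_singleton] at hb
      subst hb
      exact ⟨haout.1, haC, fun l hl hla => unclassFacets_ncard_eq_zero hU hl hla⟩
  · intro b hb hb0
    rcases List.mem_append.1 hb0 with hb0 | hb0
    · exact hS.disjoint b (hrest b hb) hb0
    · rw [List.mem_singleton] at hb0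
      exact hnd.1 (hb0 ▸ hb)
  · intro b hb hbC
    rcases hS.cover b hb hbC with h' | h' | h'
    · exact Or.inl (List.mem_append_left _ h')
    · rw [h, List.mem_cons] at h'
      rcases h' with rfl | h'
      · exact Or.inl (List.mem_append_right _ (List.mem_singleton_self _))
      · exact Or.inr (Or.inl h')
    · exact Or.inr (Or.inr h')
  · intro b hb hb'
    by_cases hba : b = a
    · subst hba
      obtain ⟨x, y, hx, hy, hne, -, -, hxa, hya, hall⟩ :=
        hL.exists_facets b hb.1 hb.2.1 hb.2.2
      rw [IsShortStar.cellBoundary_outer hx hy hne hxa hya hall]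
      have := add_mem (hρ b ha1 x (unclassFacets_ncard_eq_zero hU hx hxa) hxa)
        (hρ b ha1 y (unclassFacets_ncard_eq_zero hU hy hya) hya)
      rwa [add_add_add_comm, chain_add_self ρ, add_zero] at this
    · refine hS.boundary_mem b hb (hb'.imp_right fun hb0 => ?_)
      rcases List.mem_append.1 hb0 with hb0 | hb0
      · exact hb0
      · exact absurd (List.mem_singleton.1 hb0) hba

/-- The height function extended to newly classified cells. -/
theorem HEInvariant.height_extend {S : HEState α} (hS : HEInvariant X L σ S) :
    ∃ (T : α → ℕ) (N : ℕ), (∀ x ∈ S.classified, T x < N) ∧ (∀ x ∉ S.classified, T x = N) ∧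
      ∀ p ∈ S.vectors, ∀ l ∈ L, X.IsFacet l p.2 → l ≠ p.1 → T l < T p.1 := by
  classical
  obtain ⟨T, N, h1, h2⟩ := hS.exists_height
  -- Old descents survive because the facets in `L` of a classified head are classified, so their
  -- heights do not change.
  refine ⟨fun x => if x ∈ S.classified then T x else N, N, ?_, ?_, ?_⟩
  · intro x hx
    simpa only [if_pos hx] using h1 x hx
  · intro x hx
    exact if_neg hx
  · intro p hp l hl hlp hne
    obtain ⟨hp1, hp2⟩ := hS.vectors_mem p hp
    simpa only [if_pos hp1, if_pos (hS.closed p.2 hp2 l hl hlp)] using h2 p hp l hl hlp hne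

/-- Here `a` is a tree edge from a known vertex `x` to a new vertex `y`. Adding its boundary to the
relation joining `x` to the root joins `y` to the root, and `y` receives a height above that of `x`.
-/
theorem HEInvariant.pair (hL : IsShortStar X L σ) {S : HEState α} (hS : HEInvariant X L σ S)
    {a : α} {rest : List α} (h : S.ord1 = a :: rest) {U : Set α}
    (hU : U = unclassFacets X L S.classified a) (hU' : U.ncard ≠ 0) {C : Set α}
    (hC : C = S.classified ∪ {a} ∪ U) {new : List α}
    (hnew : Enumerates new {b | b ∈ L ∧ b ≠ σ ∧ (unclassFacets X L C b).ncard = 1 ∧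
      (X.IsFacet a b ∨ ∃ l ∈ U, X.IsFacet l b)}) {ord0 : List α} (hord0 : ord0.Nodup)
    (hord0' : ∀ b, b ∈ ord0 ↔ b ∈ S.ord0 ∧ b ∉ U) :
    HEInvariant X L σ { ord0 := ord0, ord1 := rest ++ new, classified := C
                        vectors := S.vectors ∪ {p | p.1 ∈ U ∧ p.2 = a}
                        unpaired := S.unpaired } := by
  classical
  have ha1 : a ∈ S.ord1 := h ▸ List.mem_cons_self
  have hrest : ∀ b ∈ rest, b ∈ S.ord1 := fun b hb => h ▸ List.mem_cons_of_mem a hb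
  have hnd := hS.ord1_nodup
  rw [h, List.nodup_cons] at hnd
  obtain ⟨haout, haC, x, hxC, hxa⟩ := hS.ord1_mem a ha1
  have hxL := hS.classified_subset hxC
  obtain ⟨y, hy, hne, hσx, hσy, hya, hall⟩ := hL.exists_other haout hxL hxa
  have hyC : y ∉ S.classified := by
    rw [hU] at hU'
    obtain ⟨l, hl, hla, hlC⟩ := exists_of_unclassFacets_ncard hU'
    rcases hall l hl hla with rfl | rfl
    · exact absurd hxC hlC
    · exact hlC
  rw [unclassFacets_eq_singleton hy hya hyC hxC hall] at hU
  subst hU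
  have hya' : y ≠ a := by
    rintro rfl
    exact haout.2.2 hσy
  have hmem : ∀ z, z ∈ C ↔ z ∈ S.classified ∨ z = a ∨ z = y := by
    intro z
    rw [hC, Set.mem_union, Set.mem_union, Set.mem_singleton_iff, Set.mem_singleton_iff, or_assoc]
  have hsub : S.classified ⊆ C := fun z hz => (hmem z).2 (Or.inl hz)
  have hyC' : y ∈ C := (hmem y).2 (Or.inr (Or.inr rfl))
  have haC' : a ∈ C := (hmem a).2 (Or.inr (Or.inl rfl))
  have hclosed : ∀ b ∈ C, ∀ l ∈ L, X.IsFacet l b → l ∈ C := by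
    intro b hb l hl hlb
    rcases (hmem b).1 hb with hb | rfl | rfl
    · exact hsub (hS.closed b hb l hl hlb)
    · rcases hall l hl hlb with rfl | rfl
      · exact hsub hxC
      · exact hyC'
    · exact hL.eq_of_isFacet b hσy l hl hlb ▸ hsub hS.center_mem
  -- As `a` is a facet of nothing in `L`, an edge appended now must contain `y`, and `y` is its only
  -- classified endpoint.
  have hnew' : ∀ b ∈ new, b ∈ outerCells X L σ ∧ X.IsFacet y b ∧ b ∉ C ∧
      ∀ l ∈ C, X.IsFacet l b → l = y := by
    intro b hb
    obtain ⟨hbL, hbσ, hbU, hb'⟩ := (hnew.2 b).1 hb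
    have hyb : X.IsFacet y b := by
      rcases hb' with hab | ⟨l, rfl, hlb⟩
      · exact absurd hab (hL.not_isFacet_outer haout hbL)
      · exact hlb
    have hbout : b ∈ outerCells X L σ :=
      ⟨hbL, hbσ, fun hσb => hL.ne_center hσy (hL.eq_of_isFacet b hσb y hy hyb)⟩
    obtain ⟨z, hz, hyz, -, -, hzb, hzall⟩ := hL.exists_other hbout hy hyb
    have hbU0 : (unclassFacets X L C b).ncard ≠ 0 := by omega
    obtain ⟨l, hl, hlb, hlC⟩ := exists_of_unclassFacets_ncard hbU0
    have hlz : l = z := (hzall l hl hlb).resolve_left fun e => hlC (e ▸ hyC')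
    subst hlz
    refine ⟨hbout, hyb, fun hbC => hlC (hclosed b hbC l hl hlb), fun l' hl' hlb' => ?_⟩
    have hlL' : l' ∈ L := by
      rcases (hmem l').1 hl' with h' | rfl | rfl
      · exact hS.classified_subset h'
      · exact haout.1
      · exact hy
    exact (hzall l' hlL' hlb').resolve_right fun e => hlC (e ▸ hl')
  have hmono : outerSpan X L σ S.vectors ≤
      outerSpan X L σ (S.vectors ∪ {p | p.1 ∈ ({y} : Set α) ∧ p.2 = a}) :=
    outerSpan_mono Set.subset_union_left
  have habd : cellBoundary X L a ∈
      outerSpan X L σ (S.vectors ∪ {p | p.1 ∈ ({y} : Set α) ∧ p.2 = a}) :=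
    Submodule.subset_span ⟨(y, a), Or.inr ⟨rfl, rfl⟩, haout, rfl⟩
  obtain ⟨ρ, hρ⟩ := hS.exists_root
  have hyρ : Pi.single y 1 + ρ ∈
      outerSpan X L σ (S.vectors ∪ {p | p.1 ∈ ({y} : Set α) ∧ p.2 = a}) := by
    have := add_mem habd (hmono (hρ a ha1 x hxC hxa))
    rw [IsShortStar.cellBoundary_outer hxL hy hne hxa hya hall] at this
    rwa [add_right_comm, ← add_assoc, chain_add_self, zero_add, add_comm] at this
  have hfac_a : ∀ p ∈ S.vectors, p.1 ≠ y ∧ p.2 ≠ y ∧ p.1 ≠ a ∧ p.2 ≠ a := by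
    intro p hp
    obtain ⟨h1, h2⟩ := hS.vectors_mem p hp
    exact ⟨fun e => hyC (e ▸ h1), fun e => hyC (e ▸ h2), fun e => haC (e ▸ h1),
      fun e => haC (e ▸ h2)⟩
  constructor
  · intro z hz
    rcases (hmem z).1 hz with h' | rfl | rfl
    · exact hS.classified_subset h'
    · exact haout.1
    · exact hy
  · exact hsub hS.center_mem
  · exact hclosed
  · rintro p (hp | ⟨hp1, hp2⟩)
    · exact (hS.vectors_mem p hp).imp (@hsub _) (@hsub _)
    · exact ⟨hp1 ▸ hyC', hp2 ▸ haC'⟩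
  · have hV := hS.isDiscreteVectorField
    refine ⟨?_, ?_, ?_, ?_⟩
    · rintro ⟨p1, p2⟩ (hp | ⟨rfl, rfl⟩)
      · exact hV.facet _ hp
      · exact hya
    · rintro ⟨p1, p2⟩ (hp | ⟨rfl, rfl⟩) ⟨q1, q2⟩ (hq | ⟨rfl, rfl⟩) hpq
      · exact hV.tail_inj _ hp _ hq hpq
      · exact absurd hpq (hfac_a _ hp).1
      · exact absurd hpq.symm (hfac_a _ hq).1
      · rfl
    · rintro ⟨p1, p2⟩ (hp | ⟨rfl, rfl⟩) ⟨q1, q2⟩ (hq | ⟨rfl, rfl⟩) hpq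
      · exact hV.head_inj _ hp _ hq hpq
      · exact absurd hpq (hfac_a _ hp).2.2.2
      · exact absurd hpq.symm (hfac_a _ hq).2.2.2
      · rfl
    · rintro ⟨p1, p2⟩ (hp | ⟨rfl, rfl⟩) ⟨q1, q2⟩ (hq | ⟨rfl, rfl⟩)
      · exact hV.tail_ne_head _ hp _ hq
      · exact (hfac_a _ hp).2.2.1
      · exact (hfac_a _ hq).2.1.symm
      · exact hya'
  · obtain ⟨δ, hδ⟩ := hS.exists_center
    exact ⟨δ, Or.inl hδ⟩
  · obtain ⟨T, N, h1, h2, h3⟩ := hS.height_extend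
    refine ⟨T, N + 1, ?_, ?_⟩
    · intro z _
      by_cases hz : z ∈ S.classified
      · have := h1 z hz
        omega
      · have := h2 z hz
        omega
    · rintro ⟨p1, p2⟩ (hp | ⟨rfl, rfl⟩) l hl hlp hlne
      · exact h3 _ hp l hl hlp hlne
      · rw [(hall l hl hlp).resolve_right hlne]
        exact (h2 p1 hyC).symm ▸ h1 x hxC
  · exact hord0
  · rw [List.nodup_append]
    refine ⟨hnd.2, hnew.1, ?_⟩
    rintro b hb _ hc rfl
    obtain ⟨-, hyb, -, hbC⟩ := hnew' b hc
    obtain ⟨-, -, x', hx', hxb'⟩ := hS.ord1_mem b (hrest b hb)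
    -- An edge already waiting had a classified endpoint before this step, whereas a newly appended
    -- edge has only `y`.
    exact hyC (hbC x' (hsub hx') hxb' ▸ hx')
  · intro b hb
    obtain ⟨hb0, hbU⟩ := (hord0' b).1 hb
    obtain ⟨hbL, hbC, hbf⟩ := hS.ord0_mem b hb0
    refine ⟨hbL, ?_, fun l hl hlb => hsub (hbf l hl hlb)⟩
    intro hbC'
    rcases (hmem b).1 hbC' with h' | rfl | rfl
    · exact hbC h'
    · exact hS.disjoint b ha1 hb0
    · exact hbU rfl
  · intro b hb
    rw [List.mem_append] at hb
    rcases hb with hb | hb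
    · obtain ⟨hbout, hbC, x', hx', hxb'⟩ := hS.ord1_mem b (hrest b hb)
      refine ⟨hbout, ?_, x', hsub hx', hxb'⟩
      intro hbC'
      rcases (hmem b).1 hbC' with h' | rfl | rfl
      · exact hbC h'
      · exact hnd.1 hb
      · exact hbout.2.2 hσy
    · obtain ⟨hbout, hyb, hbC, -⟩ := hnew' b hb
      exact ⟨hbout, hbC, y, hyC', hyb⟩
  · intro b hb hb0
    rw [hord0'] at hb0
    rcases List.mem_append.1 hb with hb | hb
    · exact hS.disjoint b (hrest b hb) hb0.1
    · obtain ⟨-, hyb, -⟩ := hnew' b hb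
      exact hyC ((hS.ord0_mem b hb0.1).2.2 y hy hyb)
  · intro b hb hbC
    have hbC0 : b ∉ S.classified := fun h' => hbC (hsub h')
    rcases hS.cover b hb hbC0 with h' | h' | h'
    · exact Or.inl ((hord0' b).2 ⟨h', fun e => hbC (e ▸ hyC')⟩)
    · rw [h, List.mem_cons] at h'
      rcases h' with rfl | h'
      · exact absurd haC' hbC
      · exact Or.inr (Or.inl (List.mem_append_left _ h'))
    · refine Or.inr ?_
      -- If no facet of `b` was classified before and `y` now is, the other endpoint is still
      -- unclassified, so `b` has been appended.
      by_cases hyb : X.IsFacet y b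
      · have hbσ : b ≠ σ := fun e => hbC0 (e ▸ hS.center_mem)
        have hσb : ¬X.IsFacet σ b := fun e => h' σ hL.mem e hS.center_mem
        obtain ⟨z, hz, hyz, -, hσz, hzb, hzall⟩ := hL.exists_other ⟨hb, hbσ, hσb⟩ hy hyb
        have hzC : z ∉ C := by
          intro hzC
          rcases (hmem z).1 hzC with h'' | rfl | rfl
          · exact h' z hz hzb h''
          · exact haout.2.2 hσz
          · exact hyz rfl
        refine Or.inl (List.mem_append_right _ ((hnew.2 b).2 ⟨hb, hbσ, ?_, Or.inr ⟨y, rfl, hyb⟩⟩))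
        rw [unclassFacets_eq_singleton hz hzb hzC hyC' hzall, Set.ncard_singleton]
      · refine Or.inr fun z hz hzb hzC => ?_
        rcases (hmem z).1 hzC with h'' | rfl | rfl
        · exact h' z hz hzb h''
        · exact hL.not_isFacet_outer haout hb hzb
        · exact hyb hzb
  · rintro b hb hb'
    by_cases hba : b = a
    · exact hba ▸ habd
    refine hmono (hS.boundary_mem b hb ?_)
    rcases hb' with hb' | hb'
    · rcases (hmem b).1 hb' with h' | h' | h'
      · exact Or.inl h'
      · exact absurd h' hba
      · exact absurd (h' ▸ hσy) hb.2.2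
    · exact Or.inr ((hord0' b).1 hb').1
  · refine ⟨ρ, fun b hb z hz hzb => ?_⟩
    rw [List.mem_append] at hb
    rcases hb with hb | hb
    · rcases (hmem z).1 hz with h' | rfl | rfl
      · exact hmono (hρ b (hrest b hb) z h' hzb)
      · exact absurd hzb (hL.not_isFacet_outer haout (hS.ord1_mem b (hrest b hb)).1.1)
      · exact hyρ
    · rw [(hnew' b hb).2.2.2 z hz hzb]
      exact hyρ

/-- Since `ord1` is empty, the old root may be forgotten and `c` becomes the new one: every edge
appended now has `c` as its only classified endpoint. If `c` is itself an edge, nothing is appended.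
-/
theorem HEInvariant.critical (hL : IsShortStar X L σ) {S : HEState α} (hS : HEInvariant X L σ S)
    {c : α} {rest : List α} (h1 : S.ord1 = []) (h0 : S.ord0 = c :: rest) {C : Set α}
    (hC : C = S.classified ∪ {c}) {new : List α}
    (hnew : Enumerates new {b | b ∈ L ∧ b ≠ σ ∧ (unclassFacets X L C b).ncard = 1 ∧
      X.IsFacet c b}) :
    HEInvariant X L σ { ord0 := rest, ord1 := new, classified := C, vectors := S.vectors
                        unpaired := S.unpaired ∪ {c} } := by
  classical
  have hc0 : c ∈ S.ord0 := h0 ▸ List.mem_cons_self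
  have hrest : ∀ b ∈ rest, b ∈ S.ord0 := fun b hb => h0 ▸ List.mem_cons_of_mem c hb
  have hnd := hS.ord0_nodup
  rw [h0, List.nodup_cons] at hnd
  obtain ⟨hcL, hcC, hcf⟩ := hS.ord0_mem c hc0
  have hmem : ∀ z, z ∈ C ↔ z ∈ S.classified ∨ z = c := by
    intro z
    rw [hC, Set.mem_union, Set.mem_singleton_iff]
  have hsub : S.classified ⊆ C := fun z hz => (hmem z).2 (Or.inl hz)
  have hcC' : c ∈ C := (hmem c).2 (Or.inr rfl)
  have hcσ : c ≠ σ := fun e => hcC (e ▸ hS.center_mem)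
  have hCL : C ⊆ L := by
    intro z hz
    rcases (hmem z).1 hz with h' | rfl
    · exact hS.classified_subset h'
    · exact hcL
  have hclosed : ∀ b ∈ C, ∀ l ∈ L, X.IsFacet l b → l ∈ C := by
    intro b hb l hl hlb
    rcases (hmem b).1 hb with hb | rfl
    · exact hsub (hS.closed b hb l hl hlb)
    · exact hsub (hcf l hl hlb)
  have hnew' : ∀ b ∈ new, b ∈ outerCells X L σ ∧ X.IsFacet c b ∧ b ∉ C ∧
      ∀ l ∈ C, X.IsFacet l b → l = c := by
    intro b hb
    obtain ⟨hbL, hbσ, hbU, hcb⟩ := (hnew.2 b).1 hb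
    have hbout : b ∈ outerCells X L σ :=
      ⟨hbL, hbσ, fun hσb => hcσ (hL.eq_of_isFacet b hσb c hcL hcb)⟩
    obtain ⟨z, hz, hcz, -, -, hzb, hzall⟩ := hL.exists_other hbout hcL hcb
    have hbU0 : (unclassFacets X L C b).ncard ≠ 0 := by omega
    obtain ⟨l, hl, hlb, hlC⟩ := exists_of_unclassFacets_ncard hbU0
    have hlz : l = z := (hzall l hl hlb).resolve_left fun e => hlC (e ▸ hcC')
    subst hlz
    refine ⟨hbout, hcb, fun hbC => hlC (hclosed b hbC l hl hlb), fun l' hl' hlb' => ?_⟩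
    exact (hzall l' (hCL hl') hlb').resolve_right fun e => hlC (e ▸ hl')
  refine { classified_subset := hCL, center_mem := hsub hS.center_mem, closed := hclosed
           vectors_mem := fun p hp => (hS.vectors_mem p hp).imp (@hsub _) (@hsub _)
           isDiscreteVectorField := hS.isDiscreteVectorField, exists_center := hS.exists_center
           exists_height := ?_, ord0_nodup := hnd.2, ord1_nodup := hnew.1, ord0_mem := ?_
           ord1_mem := ?_, disjoint := ?_, cover := ?_, boundary_mem := ?_
           exists_root := ⟨Pi.single c 1, ?_⟩ }
  · obtain ⟨T, N, h1, h2, h3⟩ := hS.height_extend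
    refine ⟨T, N + 1, fun z _ => ?_, h3⟩
    by_cases hz : z ∈ S.classified
    · have := h1 z hz
      omega
    · have := h2 z hz
      omega
  · intro b hb
    obtain ⟨hbL, hbC, hbf⟩ := hS.ord0_mem b (hrest b hb)
    refine ⟨hbL, ?_, fun l hl hlb => hsub (hbf l hl hlb)⟩
    intro hbC'
    rcases (hmem b).1 hbC' with h' | rfl
    · exact hbC h'
    · exact hnd.1 hb
  · intro b hb
    obtain ⟨hbout, hcb, hbC, -⟩ := hnew' b hb
    exact ⟨hbout, hbC, c, hcC', hcb⟩
  · intro b hb hb0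
    exact hcC ((hS.ord0_mem b (hrest b hb0)).2.2 c hcL (hnew' b hb).2.1)
  · intro b hb hbC
    have hbC0 : b ∉ S.classified := fun h' => hbC (hsub h')
    rcases hS.cover b hb hbC0 with h' | h' | h'
    · rw [h0, List.mem_cons] at h'
      rcases h' with rfl | h'
      · exact absurd hcC' hbC
      · exact Or.inl h'
    · rw [h1] at h'
      simp at h'
    · refine Or.inr ?_
      by_cases hcb : X.IsFacet c b
      · have hbσ : b ≠ σ := fun e => hbC0 (e ▸ hS.center_mem)
        have hσb : ¬X.IsFacet σ b := fun e => h' σ hL.mem e hS.center_mem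
        obtain ⟨z, hz, hcz, -, hσz, hzb, hzall⟩ := hL.exists_other ⟨hb, hbσ, hσb⟩ hcL hcb
        have hzC : z ∉ C := by
          intro hzC
          rcases (hmem z).1 hzC with h'' | rfl
          · exact h' z hz hzb h''
          · exact hcz rfl
        refine Or.inl ((hnew.2 b).2 ⟨hb, hbσ, ?_, hcb⟩)
        rw [unclassFacets_eq_singleton hz hzb hzC hcC' hzall, Set.ncard_singleton]
      · refine Or.inr fun z hz hzb hzC => ?_
        rcases (hmem z).1 hzC with h'' | rfl
        · exact h' z hz hzb h''
        · exact hcb hzb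
  · rintro b hb (hb' | hb')
    · rcases (hmem b).1 hb' with h' | rfl
      · exact hS.boundary_mem b hb (Or.inl h')
      · exact hS.boundary_mem b hb (Or.inr hc0)
    · exact hS.boundary_mem b hb (Or.inr (hrest b hb'))
  · intro b hb z hz hzb
    rw [(hnew' b hb).2.2.2 z hz hzb, chain_add_self]
    exact zero_mem _

theorem HEInvariant.step (hL : IsShortStar X L σ) {S S' : HEState α} (hS : HEInvariant X L σ S)
    (h : HEStep X L σ S S') : HEInvariant X L σ S' := by
  cases h with
  | defer a rest h hU => exact hS.defer hL h hU
  | pair a rest h U hU hU' C hC new hnew =>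
    exact hS.pair hL h hU hU' hC hnew (hS.ord0_nodup.filter _) (by simp)
  | critical c rest h1 h0 C hC new hnew => exact hS.critical hL h1 h0 hC hnew

theorem HEInvariant.run (hL : IsShortStar X L σ) {S S' : HEState α} (hS : HEInvariant X L σ S)
    (h : Relation.ReflTransGen (HEStep X L σ) S S') : HEInvariant X L σ S' := by
  induction h with
  | refl => exact hS
  | tail _ h ih => exact ih.step hL h

/-- With empty lists every cell of `L` is classified, so the invariant controls all outer
boundaries. Cofacets of `σ` share the restricted boundary `σ`, which is that of the head paired with
`σ`. -/
theorem HEInvariant.isPerfectMatching (hL : IsShortStar X L σ) {S : HEState α}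
    (hS : HEInvariant X L σ S) (h0 : S.ord0 = []) (h1 : S.ord1 = []) :
    IsPerfectMatching X L S.vectors := by
  have hinner : ∀ a ∈ L, X.IsFacet σ a → a ∈ S.classified := by
    intro a ha hσa
    by_contra haC
    rcases hS.cover a ha haC with h | h | h
    · simp [h0] at h
    · simp [h1] at h
    · exact h σ hL.mem hσa hS.center_mem
  obtain ⟨T, N, -, hT⟩ := hS.exists_height
  refine ⟨hS.isDiscreteVectorField, fun p hp => hS.classified_subset (hS.vectors_mem p hp).1,
    fun p hp => hS.classified_subset (hS.vectors_mem p hp).2, ⟨T, hT⟩, ?_⟩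
  intro a ha
  by_cases haσ : a = σ
  · rw [haσ, hL.cellBoundary_center]
    exact zero_mem _
  by_cases hσa : X.IsFacet σ a
  · obtain ⟨δ, hδ⟩ := hS.exists_center
    have hσδ := hS.isDiscreteVectorField.facet _ hδ
    refine Submodule.subset_span ⟨_, hδ, ?_, ?_⟩
    · rw [X.dim_eq _ _ hσδ, X.dim_eq _ _ hσa]
    · rw [hL.cellBoundary_inner hσa, hL.cellBoundary_inner hσδ]
  · have haout : a ∈ outerCells X L σ := ⟨ha, haσ, hσa⟩
    have haC : a ∈ S.classified := by
      by_contra haC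
      obtain ⟨x, y, hx, -, -, hσx, -, hxa, -⟩ := hL.exists_facets a ha haσ hσa
      rcases hS.cover a ha haC with h | h | h
      · simp [h0] at h
      · simp [h1] at h
      · exact h x hx hxa (hinner x hx hσx)
    -- All outer cells have the same dimension, so the dimension condition in the span costs
    -- nothing.
    refine Submodule.span_mono ?_ (hS.boundary_mem a haout (Or.inl haC))
    rintro c ⟨p, hp, hpout, rfl⟩
    exact ⟨p, hp, by rw [hL.dim_outer hpout, hL.dim_outer haout], rfl⟩

theorem HomotopyExpansion.isPerfectMatching (hL : IsShortStar X L σ) {I : α → ℕ}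
    {V : Set (α × α)} {M : Set α} (h : HomotopyExpansion X L σ I V M) :
    IsPerfectMatching X L V := by
  cases h with
  | trivial h =>
    refine ⟨.empty X, by simp, by simp, ⟨0, by simp⟩, ?_⟩
    intro x hx
    rw [h] at hx
    rw [Set.mem_singleton_iff.1 hx, hL.cellBoundary_center]
    exact zero_mem _
  | expand _ δ hδ hσδ _ ord0 ord1 h0 h1 S hrun hend0 hend1 =>
    exact ((HEInvariant.initial hL hδ hσδ h0 h1).run hL hrun).isPerfectMatching hL hend0 hend1

theorem exists_enumerates {β : Type*} [Finite β] (S : Set β) : ∃ l, Enumerates l S :=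
  ⟨S.toFinite.toFinset.toList, Finset.nodup_toList _, by simp⟩

/-- Termination is lexicographic: pairing or declaring a cell critical lowers the number of
unclassified cells, and deferring keeps that number but shortens `ord1`. -/
theorem HEInvariant.exists_run (hL : IsShortStar X L σ) {S : HEState α}
    (hS : HEInvariant X L σ S) :
    ∃ S', Relation.ReflTransGen (HEStep X L σ) S S' ∧ S'.ord0 = [] ∧ S'.ord1 = [] := by
  classical
  induction hk : (S.classifiedᶜ).ncard using Nat.strong_induction_on generalizing S with
  | _ k ihk =>
  have hlt : ∀ {C : Set α} {z : α}, S.classified ⊆ C → z ∈ C → z ∉ S.classified →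
      Cᶜ.ncard < k := by
    intro C z hC hz hz'
    rw [← hk]
    refine Set.ncard_lt_ncard ⟨Set.compl_subset_compl.2 hC, fun h => h hz' hz⟩
  induction hm : S.ord1.length generalizing S with
  | zero =>
    rw [List.length_eq_zero_iff] at hm
    rcases h0 : S.ord0 with _ | ⟨c, rest⟩
    · exact ⟨S, .refl, h0, hm⟩
    · obtain ⟨new, hnew⟩ := exists_enumerates {b | b ∈ L ∧ b ≠ σ ∧
        (unclassFacets X L (S.classified ∪ {c}) b).ncard = 1 ∧ X.IsFacet c b}
      have hstep := HEStep.critical (X := X) (L := L) (σ := σ) S c rest hm h0 _ rfl new hnew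
      obtain ⟨S', hS', h'⟩ := ihk _ (hlt (C := S.classified ∪ {c}) Set.subset_union_left (Or.inr rfl)
        (hS.ord0_mem c (h0 ▸ List.mem_cons_self)).2.1) (hS.step hL hstep) rfl
      exact ⟨S', .head hstep hS', h'⟩
  | succ m ihm =>
    obtain ⟨a, rest, h1⟩ := List.exists_cons_of_length_eq_add_one hm
    by_cases hU : (unclassFacets X L S.classified a).ncard = 0
    · have hstep := HEStep.defer (X := X) (L := L) (σ := σ) S a rest h1 hU
      obtain ⟨S', hS', h'⟩ := ihm (hS.step hL hstep) hk hlt (by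
        rw [h1, List.length_cons] at hm
        exact Nat.succ_injective hm)
      exact ⟨S', .head hstep hS', h'⟩
    · obtain ⟨new, hnew⟩ := exists_enumerates {b | b ∈ L ∧ b ≠ σ ∧
        (unclassFacets X L (S.classified ∪ {a} ∪ unclassFacets X L S.classified a) b).ncard = 1 ∧
        (X.IsFacet a b ∨ ∃ l ∈ unclassFacets X L S.classified a, X.IsFacet l b)}
      have hstep := HEStep.pair (X := X) (L := L) (σ := σ) S a rest h1 _ rfl hU _ rfl new hnew
      obtain ⟨S', hS', h'⟩ := ihk _ (hlt
        (C := S.classified ∪ {a} ∪ unclassFacets X L S.classified a)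
        (Set.subset_union_left.trans Set.subset_union_left) (Or.inl (Or.inr rfl))
        (hS.ord1_mem a (h1 ▸ List.mem_cons_self)).2.1) (hS.step hL hstep) rfl
      exact ⟨S', .head hstep hS', h'⟩

/-- A first cofacet `δ` is available when `L ≠ {σ}`, because an outer cell would itself have
cofacets of `σ` among its facets. -/
theorem exists_homotopyExpansion (hL : IsShortStar X L σ) (I : α → ℕ) :
    ∃ V M, HomotopyExpansion X L σ I V M := by
  by_cases h : L = {σ}
  · exact ⟨∅, {σ}, .trivial h⟩
  · have hne : {δ | δ ∈ L ∧ X.IsFacet σ δ}.Nonempty := by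
      by_contra hempty
      rw [Set.not_nonempty_iff_eq_empty] at hempty
      have hno : ∀ δ ∈ L, ¬X.IsFacet σ δ := fun δ h1 h2 =>
        (Set.eq_empty_iff_forall_notMem.1 hempty) δ ⟨h1, h2⟩
      refine h (Set.eq_singleton_iff_unique_mem.2 ⟨hL.mem, fun a ha => ?_⟩)
      by_contra haσ
      obtain ⟨x, y, hx, -, -, hσx, -⟩ := hL.exists_facets a ha haσ (hno a ha)
      exact hno x hx hσx
    obtain ⟨δ, ⟨hδ, hσδ⟩, hmin⟩ := Set.exists_min_image _ I (Set.toFinite _) hne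
    obtain ⟨ord0, h0⟩ := exists_enumerates
      {a | a ∈ L ∧ a ≠ σ ∧ a ≠ δ ∧ (unclassFacets X L {σ, δ} a).ncard = 0}
    obtain ⟨ord1, h1⟩ := exists_enumerates
      {a | a ∈ L ∧ a ≠ σ ∧ (unclassFacets X L {σ, δ} a).ncard = 1 ∧ X.IsFacet δ a}
    obtain ⟨S, hrun, hend0, hend1⟩ := (HEInvariant.initial hL hδ hσδ h0 h1).exists_run hL
    exact ⟨_, _, .expand h δ hδ hσδ (fun δ' h1 h2 => hmin δ' ⟨h1, h2⟩) ord0 ord1 h0 h1 S hrun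
      hend0 hend1⟩

end ShortStar

/-! ### Relative homology by counting ranks -/

section Homology

theorem finrank_map_add_finrank_inf_ker {k M N : Type*} [Field k] [AddCommGroup M] [Module k M]
    [AddCommGroup N] [Module k N] [FiniteDimensional k M] (f : M →ₗ[k] N) (p : Submodule k M) :
    Module.finrank k (p.map f) + Module.finrank k (p ⊓ f.ker : Submodule k M) =
      Module.finrank k p := by
  rw [← (f.domRestrict p).finrank_range_add_finrank_ker, LinearMap.range_domRestrict,
    LinearMap.ker_domRestrict, ← Submodule.map_comap_subtype p f.ker]
  congr 1
  exact (Submodule.equivMapOfInjective p.subtype p.injective_subtype _).finrank_eq.symm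

variable {α : Type*}

theorem chains_mono {S T : Set α} (h : S ⊆ T) : chains S ≤ chains T :=
  fun _ hc a ha => hc a fun ha' => ha (h ha')

theorem restrictChain_eq_zero_iff {L : Set α} {c : α → ZMod 2} :
    restrictChain L c = 0 ↔ ∀ a ∈ L, c a = 0 := by
  rw [restrictChain_apply, Set.indicator_eq_zero', Set.disjoint_left]
  exact ⟨fun h a ha => by_contra fun hc => h hc ha, fun h a hc ha => hc (h a ha)⟩

variable [Fintype α]

open Classical in
theorem chains_eq_span (S : Set α) :
    chains S = Submodule.span (ZMod 2) ((fun a => Pi.single a (1 : ZMod 2)) '' S) := by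
  apply le_antisymm
  · intro c hc
    have : c = ∑ a, c a • (Pi.single a (1 : ZMod 2) : α → ZMod 2) := by
      rw [← Finset.univ_sum_single c]
      refine Finset.sum_congr rfl fun a _ => ?_
      rw [Finset.univ_sum_single, ← Pi.single_smul, smul_eq_mul, mul_one]
    rw [this]
    refine Submodule.sum_mem _ fun a _ => ?_
    by_cases ha : a ∈ S
    · exact Submodule.smul_mem _ _ (Submodule.subset_span ⟨a, ha, rfl⟩)
    · rw [hc a ha, zero_smul]
      exact zero_mem _
  · rw [Submodule.span_le]
    rintro _ ⟨a, ha, rfl⟩ b hb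
    exact Pi.single_eq_of_ne (fun e => hb (by rwa [e])) _

theorem finrank_chains (S : Set α) : Module.finrank (ZMod 2) (chains S) = S.ncard := by
  classical
  have hli : LinearIndependent (ZMod 2) fun a : S => (Pi.single a.1 1 : α → ZMod 2) := by
    have := (Pi.basisFun (ZMod 2) α).linearIndependent.comp (Subtype.val : S → α)
      Subtype.val_injective
    simpa [Function.comp_def] using this
  rw [chains_eq_span, Set.image_eq_range, finrank_span_eq_card hli, Fintype.card_eq_nat_card,
    Nat.card_coe_set_eq]

variable (X : CellComplex α)

theorem boundary_single [DecidableEq α] (κ : α → α → ZMod 2) (x : α) :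
    boundary κ (Pi.single x 1) = κ x := by
  rw [boundary, Fintype.linearCombination_apply_single, one_smul]

theorem boundary_apply (κ : α → α → ZMod 2) (c : α → ZMod 2) (s : α) :
    boundary κ c s = ∑ x, c x * κ x s := by
  rw [boundary, Fintype.linearCombination_apply, Finset.sum_apply]
  rfl

theorem boundary_boundary (c : α → ZMod 2) : boundary X.κ (boundary X.κ c) = 0 := by
  funext s
  simp only [boundary_apply, Finset.sum_mul]
  rw [Finset.sum_comm]
  simp only [mul_assoc, ← Finset.mul_sum, X.sum_eq_zero, mul_zero, Finset.sum_const_zero,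
    Pi.zero_apply]

theorem boundary_mem_chains {S T : Set α} (h : ∀ t ∈ S, ∀ s, X.IsFacet s t → s ∈ T)
    {c : α → ZMod 2} (hc : c ∈ chains S) : boundary X.κ c ∈ chains T := by
  intro s hs
  rw [boundary_apply]
  refine Finset.sum_eq_zero fun t _ => ?_
  by_cases ht : t ∈ S
  · rw [X.κ_eq_zero fun hst => hs (h t ht s hst), mul_zero]
  · rw [hc t ht, zero_mul]

/-- The span of the boundaries in `L` of the `q`-cells of `L`. -/
def boundarySpan (L : Set α) (q : ℤ) : Submodule (ZMod 2) (α → ZMod 2) :=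
  Submodule.span (ZMod 2) (cellBoundary X L '' X.cellsOfDim L q)

variable {X} {A B : Set α}

/-- Cells of the subcomplex `B` have no boundary outside `B`, so they contribute nothing. -/
theorem map_chains_cellsOfDim (hB : ∀ t ∈ B, ∀ s, X.IsFacet s t → s ∈ B) (q : ℤ) : (chains (X.cellsOfDim A q)).map (restrictChain (A \ B) ∘ₗ boundary X.κ) =
      boundarySpan X (A \ B) q := by
  classical
  rw [chains_eq_span, Submodule.map_span, ← Set.image_comp]
  have hD : ((restrictChain (A \ B) ∘ₗ boundary X.κ) ∘ fun a => Pi.single a (1 : ZMod 2)) =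
      cellBoundary X (A \ B) := by
    funext a
    rw [Function.comp_apply, LinearMap.comp_apply, boundary_single]
    rfl
  rw [hD]
  apply le_antisymm
  · rw [Submodule.span_le]
    rintro _ ⟨x, ⟨hxA, hxq⟩, rfl⟩
    by_cases hxB : x ∈ B
    · have : cellBoundary X (A \ B) x = 0 :=
        restrictChain_eq_zero_iff.2 fun s hs => X.κ_eq_zero fun hsx => hs.2 (hB x hxB s hsx)
      rw [this]
      exact zero_mem _
    · exact Submodule.subset_span ⟨x, ⟨⟨hxA, hxB⟩, hxq⟩, rfl⟩
  · exact Submodule.span_mono (Set.image_mono fun x hx => ⟨hx.1.1, hx.2⟩)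

/-- The quotient complex has the cells of `A \ B` as basis, so this is the usual formula for
homology in terms of ranks, written additively to avoid truncated subtraction. -/
theorem finrank_relHomology (hA : ∀ t ∈ A, ∀ s, X.IsFacet s t → s ∈ A)
    (hB : ∀ t ∈ B, ∀ s, X.IsFacet s t → s ∈ B) (hBA : B ⊆ A) (q : ℤ) :
    Module.finrank (ZMod 2) (X.RelHomology A B q) +
      Module.finrank (ZMod 2) (boundarySpan X (A \ B) q) +
      Module.finrank (ZMod 2) (boundarySpan X (A \ B) (q + 1)) =
      (X.cellsOfDim (A \ B) q).ncard := by
  have hZ : X.relCycles A B q =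
      chains (X.cellsOfDim A q) ⊓ (restrictChain (A \ B) ∘ₗ boundary X.κ).ker := by
    ext c
    refine and_congr_right fun hc => ?_
    have hc' := boundary_mem_chains X (T := A) (fun t ht s hst => hA t ht.1 s hst) hc
    change boundary X.κ c ∈ chains B ↔ restrictChain (A \ B) (boundary X.κ c) = 0
    rw [restrictChain_eq_zero_iff]
    refine ⟨fun h a ha => h a ha.2, fun h a ha => ?_⟩
    by_cases haA : a ∈ A
    · exact h a ⟨haA, ha⟩
    · exact hc' a haA
  have hdA : (chains (X.cellsOfDim A (q + 1))).map (boundary X.κ) ≤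
      chains (X.cellsOfDim A q) := by
    rintro _ ⟨c, hc, rfl⟩
    refine boundary_mem_chains X (S := X.cellsOfDim A (q + 1)) (T := X.cellsOfDim A q)
      (fun t ht s hst => ⟨hA t ht.1 s hst, ?_⟩) hc
    have h1 := ht.2
    rw [X.dim_eq t s hst] at h1
    push_cast at h1
    exact add_right_cancel h1
  have hBAq : chains (X.cellsOfDim B q) ≤ chains (X.cellsOfDim A q) :=
    chains_mono fun x hx => ⟨hBA hx.1, hx.2⟩
  have hle : X.relBoundaries A B q ≤ X.relCycles A B q := by
    refine sup_le (le_inf hdA ?_) (le_inf hBAq ?_)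
    · rintro _ ⟨c, -, rfl⟩
      rw [Submodule.mem_comap, boundary_boundary]
      exact zero_mem _
    · intro c hc
      exact boundary_mem_chains X (fun t ht s hst => hB t ht.1 s hst) hc
  have hres : (chains (X.cellsOfDim B q)).map (restrictChain (A \ B)) = ⊥ := by
    rw [eq_bot_iff]
    rintro _ ⟨c, hc, rfl⟩
    exact restrictChain_eq_zero_iff.2 fun a ha => hc a fun ha' => ha.2 ha'.1
  have hBd : (X.relBoundaries A B q).map (restrictChain (A \ B)) =
      boundarySpan X (A \ B) (q + 1) := by
    rw [CellComplex.relBoundaries, Submodule.map_sup, hres, sup_bot_eq, ← Submodule.map_comp,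
      map_chains_cellsOfDim hB]
  have hBker : X.relBoundaries A B q ⊓ (restrictChain (A \ B)).ker =
      chains (X.cellsOfDim B q) := by
    apply le_antisymm
    · rintro c ⟨hc, hc0⟩ a ha
      have hcA : c ∈ chains (X.cellsOfDim A q) := (sup_le hdA hBAq) hc
      by_cases haA : a ∈ X.cellsOfDim A q
      · exact restrictChain_eq_zero_iff.1 hc0 a ⟨haA.1, fun haB => ha ⟨haB, haA.2⟩⟩
      · exact hcA a haA
    · exact le_inf le_sup_right fun c hc =>
        restrictChain_eq_zero_iff.2 fun a ha => hc a fun ha' => ha.2 ha'.1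
  -- Rank-nullity is used twice: the kernel is the relative cycles in `e1` and the `q`-chains of `B`
  -- in `e2`. The cells of `B` cancel in the end.
  have e1 := finrank_map_add_finrank_inf_ker (restrictChain (A \ B) ∘ₗ boundary X.κ)
    (chains (X.cellsOfDim A q))
  rw [map_chains_cellsOfDim hB, ← hZ, finrank_chains] at e1
  have e2 := finrank_map_add_finrank_inf_ker (restrictChain (A \ B)) (X.relBoundaries A B q)
  rw [hBd, hBker, finrank_chains] at e2
  have e3 := ((X.relBoundaries A B q).submoduleOf
    (X.relCycles A B q)).finrank_quotient_add_finrank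
  rw [(Submodule.submoduleOfEquivOfLe hle).finrank_eq] at e3
  change Module.finrank (ZMod 2) (X.RelHomology A B q) + _ = _ at e3
  have e4 : (X.cellsOfDim A q).ncard =
      (X.cellsOfDim (A \ B) q).ncard + (X.cellsOfDim B q).ncard := by
    rw [← Set.ncard_union_eq (Set.disjoint_left.2 fun a ha ha' => ha.1.2 ha'.1) (Set.toFinite _)
      (Set.toFinite _)]
    congr 1
    ext a
    constructor
    · intro ha
      by_cases haB : a ∈ B
      · exact Or.inr ⟨haB, ha.2⟩
      · exact Or.inl ⟨⟨ha.1, haB⟩, ha.2⟩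
    · rintro (ha | ha)
      · exact ⟨ha.1.1, ha.2⟩
      · exact ⟨hBA ha.1, ha.2⟩
  omega

variable {L : Set α} {W : Set (α × α)}

/-- Triangularity: in a vanishing combination, take a pair with nonzero coefficient whose tail is
highest. That tail lies in no other head boundary of the combination, since such a head would have a
still higher tail. -/
theorem IsPerfectMatching.linearIndependent (h : IsPerfectMatching X L W) :
    LinearIndependent (ZMod 2) fun p : W => cellBoundary X L p.1.2 := by
  classical
  rw [Fintype.linearIndependent_iff]
  intro g hg
  by_contra! hne
  obtain ⟨T, hT⟩ := h.exists_height
  obtain ⟨p, hp, hmax⟩ := Set.exists_max_image {p : W | g p ≠ 0} (fun p => T p.1.1)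
    (Set.toFinite _) hne
  have hp0 := congrFun hg p.1.1
  rw [Finset.sum_apply, Finset.sum_eq_single p] at hp0
  · rw [Pi.smul_apply, cellBoundary, restrictChain_apply,
      Set.indicator_of_mem (h.tail_mem _ p.2),
      CellComplex.κ_eq_one_iff.2 (h.isDiscreteVectorField.facet _ p.2), smul_eq_mul, mul_one] at hp0
    exact hp hp0
  · intro p' _ hne'
    rw [Pi.smul_apply, cellBoundary, restrictChain_apply,
      Set.indicator_of_mem (h.tail_mem _ p.2), smul_eq_mul, mul_eq_zero]
    by_contra! hc
    have := hmax p' hc.1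
    have := hT p'.1 p'.2 p.1.1 (h.tail_mem _ p.2) hc.2 fun e =>
      hne' (Subtype.ext (h.isDiscreteVectorField.tail_inj _ p'.2 _ p.2 e.symm))
    omega
  · exact fun hp' => absurd (Finset.mem_univ p) hp'

theorem IsPerfectMatching.finrank_boundarySpan (h : IsPerfectMatching X L W) (q : ℤ) :
    Module.finrank (ZMod 2) (boundarySpan X L q) =
      {p | p ∈ W ∧ (X.dim p.2 : ℤ) = q}.ncard := by
  have hspan : boundarySpan X L q = Submodule.span (ZMod 2)
      (Set.range fun p : {p | p ∈ W ∧ (X.dim p.2 : ℤ) = q} => cellBoundary X L p.1.2) := by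
    apply le_antisymm
    · rw [boundarySpan, Submodule.span_le]
      rintro _ ⟨x, ⟨hxL, hxq⟩, rfl⟩
      refine Submodule.span_mono ?_ (h.boundary_mem x hxL)
      rintro _ ⟨p, hp, hpx, rfl⟩
      exact ⟨⟨p, hp, hpx ▸ hxq⟩, rfl⟩
    · refine Submodule.span_mono ?_
      rintro _ ⟨⟨p, hp, hpq⟩, rfl⟩
      exact ⟨p.2, ⟨h.head_mem p hp, hpq⟩, rfl⟩
  have hli : LinearIndependent (ZMod 2)
      fun p : {p | p ∈ W ∧ (X.dim p.2 : ℤ) = q} => cellBoundary X L p.1.2 :=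
    h.linearIndependent.comp
    (fun p : {p | p ∈ W ∧ (X.dim p.2 : ℤ) = q} => (⟨p.1, p.2.1⟩ : W))
    fun p p' e => Subtype.ext (congrArg (fun z : W => z.1) e)
  have := Fintype.ofFinite {p | p ∈ W ∧ (X.dim p.2 : ℤ) = q}
  rw [hspan, finrank_span_eq_card hli, Fintype.card_eq_nat_card, Nat.card_coe_set_eq]

/-- The `q`-cells split into critical cells, heads, and tails of `(q+1)`-dimensional heads. The last
two classes count the ranks of the boundary maps out of degrees `q` and `q + 1`. -/
theorem IsPerfectMatching.ncard_critical (h : IsPerfectMatching X (A \ B) W)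
    (hA : ∀ t ∈ A, ∀ s, X.IsFacet s t → s ∈ A) (hB : ∀ t ∈ B, ∀ s, X.IsFacet s t → s ∈ B)
    (hBA : B ⊆ A) (q : ℤ) :
    {c | c ∈ X.cellsOfDim (A \ B) q ∧ IsCritical W c}.ncard =
      Module.finrank (ZMod 2) (X.RelHomology A B q) := by
  have e := finrank_relHomology hA hB hBA q
  rw [h.finrank_boundarySpan, h.finrank_boundarySpan] at e
  have hV := h.isDiscreteVectorField
  have hheads : (Prod.snd '' {p | p ∈ W ∧ (X.dim p.2 : ℤ) = q}).ncard =
      {p | p ∈ W ∧ (X.dim p.2 : ℤ) = q}.ncard :=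
    Set.InjOn.ncard_image fun p hp p' hp' => hV.head_inj p hp.1 p' hp'.1
  have htails : (Prod.fst '' {p | p ∈ W ∧ (X.dim p.2 : ℤ) = q + 1}).ncard =
      {p | p ∈ W ∧ (X.dim p.2 : ℤ) = q + 1}.ncard :=
    Set.InjOn.ncard_image fun p hp p' hp' => hV.tail_inj p hp.1 p' hp'.1
  have hdim : ∀ p ∈ W, (X.dim p.2 : ℤ) = q + 1 → (X.dim p.1 : ℤ) = q := by
    intro p hp hq
    rw [X.dim_eq _ _ (hV.facet p hp)] at hq
    push_cast at hq
    exact add_right_cancel hq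
  have hdim' : ∀ p ∈ W, (X.dim p.1 : ℤ) = q → (X.dim p.2 : ℤ) = q + 1 := by
    intro p hp hq
    rw [X.dim_eq _ _ (hV.facet p hp), ← hq]
    push_cast
    rfl
  have hd1 : Disjoint (Prod.snd '' {p | p ∈ W ∧ (X.dim p.2 : ℤ) = q})
      (Prod.fst '' {p | p ∈ W ∧ (X.dim p.2 : ℤ) = q + 1}) := by
    rw [Set.disjoint_left]
    rintro _ ⟨p, hp, rfl⟩ ⟨p', hp', e'⟩
    exact hV.tail_ne_head p' hp'.1 p hp.1 e'
  have hd2 : Disjoint {c | c ∈ X.cellsOfDim (A \ B) q ∧ IsCritical W c}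
      (Prod.snd '' {p | p ∈ W ∧ (X.dim p.2 : ℤ) = q} ∪
        Prod.fst '' {p | p ∈ W ∧ (X.dim p.2 : ℤ) = q + 1}) := by
    rw [Set.disjoint_left]
    rintro c ⟨-, hc⟩ (⟨p, hp, rfl⟩ | ⟨p, hp, rfl⟩)
    · exact (hc p hp.1).2 rfl
    · exact (hc p hp.1).1 rfl
  have hunion : X.cellsOfDim (A \ B) q = {c | c ∈ X.cellsOfDim (A \ B) q ∧ IsCritical W c} ∪
      (Prod.snd '' {p | p ∈ W ∧ (X.dim p.2 : ℤ) = q} ∪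
        Prod.fst '' {p | p ∈ W ∧ (X.dim p.2 : ℤ) = q + 1}) := by
    apply Set.Subset.antisymm
    · intro c hc
      by_cases hcrit : IsCritical W c
      · exact Or.inl ⟨hc, hcrit⟩
      · rw [IsCritical] at hcrit
        push Not at hcrit
        obtain ⟨p, hp, hpc⟩ := hcrit
        by_cases hp1 : p.1 = c
        · exact Or.inr (Or.inr ⟨p, ⟨hp, hdim' p hp (hp1 ▸ hc.2)⟩, hp1⟩)
        · exact Or.inr (Or.inl ⟨p, ⟨hp, hpc hp1 ▸ hc.2⟩, hpc hp1⟩)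
    · rintro c (hc | ⟨p, hp, rfl⟩ | ⟨p, hp, rfl⟩)
      · exact hc.1
      · exact ⟨h.head_mem p hp.1, hp.2⟩
      · exact ⟨h.tail_mem p hp.1, hdim p hp.1 hp.2⟩
  have e' := congrArg Set.ncard hunion
  rw [Set.ncard_union_eq hd2 (Set.toFinite _) (Set.toFinite _),
    Set.ncard_union_eq hd1 (Set.toFinite _) (Set.toFinite _), hheads, htails] at e'
  omega

end Homology

/-! ### Parity of `V`-paths as a functional on chains -/

section PathParity

variable {α : Type*} [Fintype α] {X : CellComplex α} {V : Set (α × α)}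

open Classical in
variable (X V) in
/-- The parity of the number of `V`-paths from `r` to `s`, the trivial one included. -/
def pathParity (s r : α) : ZMod 2 :=
  (if r = s then 1 else 0) + (Nat.card (VPath X V r s) : ZMod 2)

open Classical in
theorem natCard_plift (p : Prop) : Nat.card (PLift p) = if p then 1 else 0 := by
  by_cases h : p
  · rw [if_pos h]
    have : Unique (PLift p) := ⟨⟨⟨h⟩⟩, fun _ => rfl⟩
    exact Nat.card_unique
  · rw [if_neg h]
    have : IsEmpty (PLift p) := ⟨fun x => h x.down⟩
    exact Nat.card_of_isEmpty

/-- A separatrix is a facet of `t` followed by a possibly trivial `V`-path to `s`. Finiteness of the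
path types lets `Nat.card` split over the sum. -/
theorem sum_pathParity_separatrix (hV : IsDiscreteGradient X V) (t s : α) :
    (Nat.card (Separatrix X V t s) : ZMod 2) = ∑ x, X.κ t x * pathParity X V s x := by
  classical
  have := VPath.finite hV
  rw [Nat.card_sum, Nat.card_sigma, natCard_plift]
  simp only [pathParity, mul_add, Finset.sum_add_distrib, mul_ite, mul_one, mul_zero,
    Finset.sum_ite_eq', Finset.mem_univ, if_true]
  push_cast
  congr 1
  · by_cases h : X.IsFacet s t
    · rw [if_pos h, CellComplex.κ_eq_one_iff.2 h]
    · rw [if_neg h, X.κ_eq_zero h]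
  · rw [← Finset.sum_subtype (Finset.univ.filter fun x => X.IsFacet x t) (by simp)
      (fun x => (Nat.card (VPath X V x s) : ZMod 2)), Finset.sum_filter]
    refine Finset.sum_congr rfl fun x _ => ?_
    by_cases h : X.IsFacet x t
    · rw [CellComplex.κ_eq_one_iff.2 h, one_mul, if_pos h]
    · rw [X.κ_eq_zero h, zero_mul, if_neg h]

/-- The tail determines its head, so every `V`-path from `r` first passes through `t` to another
facet, and there it stops or continues. -/
theorem natCard_vPath (hV : IsDiscreteGradient X V) {r t : α} (h : (r, t) ∈ V) (s : α) :
    Nat.card (VPath X V r s) =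
      Nat.card (Σ x : {x // X.IsFacet x t ∧ x ≠ r}, PLift (x.1 = s) ⊕ VPath X V x.1 s) := by
  symm
  refine Nat.card_congr (Equiv.ofBijective (fun z => match z with
    | ⟨x, .inl e⟩ => .single h (e.down ▸ x.2.1) (e.down ▸ x.2.2)
    | ⟨x, .inr p⟩ => .cons h x.2.1 x.2.2 p) ⟨?_, ?_⟩)
  · rintro ⟨⟨x, hx⟩, ⟨⟨e⟩⟩ | p⟩ ⟨⟨y, hy⟩, ⟨⟨e'⟩⟩ | p'⟩ heq
    · have hxs : x = s := e
      have hys : y = s := e'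
      subst hxs
      subst hys
      rfl
    · simp at heq
    · simp at heq
    · simp only [VPath.cons.injEq, true_and] at heq
      obtain ⟨rfl, heq⟩ := heq
      rw [eq_of_heq heq]
  · have huniq : ∀ {t'}, (r, t') ∈ V → t' = t := fun h' =>
      congrArg Prod.snd (hV.1.tail_inj _ h' _ h rfl)
    intro p
    cases p with
    | single h' hf hne =>
      obtain rfl := huniq h'
      exact ⟨⟨⟨s, hf, hne⟩, .inl ⟨rfl⟩⟩, rfl⟩
    | cons h' hf hne p =>
      obtain rfl := huniq h'
      exact ⟨⟨⟨_, hf, hne⟩, .inr p⟩, rfl⟩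

/-- The value at the tail `r` equals the sum over the other facets of `t`; there is no trivial path
at `r` because `s` is critical. The total is twice that value. -/
theorem sum_pathParity_head (hV : IsDiscreteGradient X V) {r t s : α} (h : (r, t) ∈ V)
    (hs : IsCritical V s) : ∑ x, X.κ t x * pathParity X V s x = 0 := by
  classical
  have := VPath.finite hV
  have hr : pathParity X V s r =
      ∑ x ∈ Finset.univ.erase r, X.κ t x * pathParity X V s x := by
    rw [pathParity, if_neg (hs _ h).1, zero_add, natCard_vPath hV h, Nat.card_sigma]
    push_cast
    rw [← Finset.sum_subtype (Finset.univ.filter fun x => X.IsFacet x t ∧ x ≠ r) (by simp)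
      (fun x => (Nat.card (PLift (x = s) ⊕ VPath X V x s) : ZMod 2)), Finset.sum_filter,
      ← Finset.sum_erase_add _ _ (Finset.mem_univ r)]
    rw [if_neg (by simp), add_zero]
    refine Finset.sum_congr rfl fun x hx => ?_
    by_cases hxt : X.IsFacet x t
    · rw [CellComplex.κ_eq_one_iff.2 hxt, one_mul, if_pos ⟨hxt, Finset.ne_of_mem_erase hx⟩,
        Nat.card_sum, natCard_plift, pathParity]
      push_cast
      rfl
    · rw [X.κ_eq_zero hxt, zero_mul, if_neg fun h' => hxt h'.1]
  rw [← Finset.sum_erase_add _ _ (Finset.mem_univ r), ← hr,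
    CellComplex.κ_eq_one_iff.2 (hV.1.facet _ h), one_mul]
  exact CharTwo.add_self_eq_zero _

/-- The parity functional `Φ` vanishes on head boundaries, and these span all boundaries in `L`. By
`hzero`, facets outside `L` do not contribute, so restricting to `L` loses nothing. -/
theorem IsPerfectMatching.sum_pathParity {L : Set α} {W : Set (α × α)}
    (hW : IsPerfectMatching X L W) (hWV : W ⊆ V) (hV : IsDiscreteGradient X V) {s : α}
    (hs : IsCritical V s)
    (hzero : ∀ t ∈ L, ∀ x, x ∉ L → X.IsFacet x t → pathParity X V s x = 0) {t : α} (ht : t ∈ L) :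
    ∑ x, X.κ t x * pathParity X V s x = 0 := by
  classical
  let Φ := Fintype.linearCombination (ZMod 2) (pathParity X V s)
  have hΦ : ∀ t ∈ L, Φ (cellBoundary X L t) = ∑ x, X.κ t x * pathParity X V s x := by
    intro t ht
    rw [Fintype.linearCombination_apply]
    refine Finset.sum_congr rfl fun x _ => ?_
    rw [cellBoundary, restrictChain_apply, smul_eq_mul]
    by_cases hx : x ∈ L
    · rw [Set.indicator_of_mem hx]
    · rw [Set.indicator_of_notMem hx, zero_mul]
      by_cases hxt : X.IsFacet x t
      · rw [hzero t ht x hx hxt, mul_zero]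
      · rw [X.κ_eq_zero hxt, zero_mul]
  have hker : Submodule.span (ZMod 2)
      {c | ∃ p ∈ W, X.dim p.2 = X.dim t ∧ c = cellBoundary X L p.2} ≤ Φ.ker := by
    rw [Submodule.span_le]
    rintro _ ⟨p, hp, -, rfl⟩
    exact (hΦ p.2 (hW.head_mem p hp)).trans (sum_pathParity_head hV (hWV hp) hs)
  rw [← hΦ t ht]
  exact hker (hW.boundary_mem t ht)

end PathParity

/-! ### From level sets to the whole filtration -/

section Levelwise

variable {α : Type*} {n : ℕ} {g : α → Fin n → ℤ}

/-- Grades are integers: if `g t ≤ u` is strict in coordinate `i`, then already `g t ≤ u - e_i`. -/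
theorem sublevel_sdiff_previous (u : Fin n → ℤ) :
    {t | g t ≤ u} \ previous (fun u => {t | g t ≤ u}) u = {t | g t = u} := by
  ext t
  simp only [previous, Set.mem_sdiff, Set.mem_ofPred_eq, Set.mem_iUnion, not_exists]
  constructor
  · rintro ⟨h1, h2⟩
    refine le_antisymm h1 fun i => ?_
    by_contra! hi
    refine h2 i fun j => ?_
    by_cases hj : j = i
    · subst hj
      rw [Pi.sub_apply, Pi.single_eq_same]
      exact Int.le_sub_one_of_lt hi
    · rw [Pi.sub_apply, Pi.single_eq_of_ne hj, sub_zero]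
      exact h1 j
  · rintro rfl
    refine ⟨le_rfl, fun i hi => ?_⟩
    have := hi i
    rw [Pi.sub_apply, Pi.single_eq_same] at this
    exact absurd this (not_le.2 (sub_one_lt (g t i)))

theorem previous_subset (u : Fin n → ℤ) :
    previous (fun u => {t | g t ≤ u}) u ⊆ {t | g t ≤ u} := by
  refine Set.iUnion_subset fun i t (ht : g t ≤ _) => ht.trans ?_
  exact sub_le_self u (Pi.single_nonneg.2 zero_le_one)

variable [Fintype α] {X : CellComplex α}

variable (X g) in
/-- A set of pairs of cells with the same grade that is a perfect matching of every level set. -/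
structure IsLevelwisePerfect (V : Set (α × α)) : Prop where
  monotone : ∀ s t, X.IsFacet s t → g s ≤ g t
  grade_eq : ∀ p ∈ V, g p.1 = g p.2
  isPerfectMatching : ∀ u, IsPerfectMatching X {t | g t = u} {p | p ∈ V ∧ g p.1 = u}

variable {V : Set (α × α)}

namespace IsLevelwisePerfect

theorem isDiscreteVectorField (h : IsLevelwisePerfect g X V) : IsDiscreteVectorField X V where
  facet p hp := (h.isPerfectMatching _).isDiscreteVectorField.facet p ⟨hp, rfl⟩
  tail_inj p hp p' hp' e :=
    (h.isPerfectMatching _).isDiscreteVectorField.tail_inj p ⟨hp, rfl⟩ p' ⟨hp', by rw [e]⟩ e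
  head_inj p hp p' hp' e :=
    (h.isPerfectMatching _).isDiscreteVectorField.head_inj p ⟨hp, rfl⟩ p'
      ⟨hp', by rw [h.grade_eq p hp, h.grade_eq p' hp', e]⟩ e
  tail_ne_head p hp p' hp' e :=
    (h.isPerfectMatching _).isDiscreteVectorField.tail_ne_head p ⟨hp, rfl⟩ p'
      ⟨hp', by rw [h.grade_eq p' hp', e]⟩ e

theorem grade_le_of_vPath (h : IsLevelwisePerfect g X V) {r s : α} (p : VPath X V r s) :
    g s ≤ g r := by
  induction p with
  | single hp hf _ => exact (h.monotone _ _ hf).trans (h.grade_eq _ hp).ge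
  | cons hp hf _ _ ih => exact ih.trans ((h.monotone _ _ hf).trans (h.grade_eq _ hp).ge)

/-- Grades never increase along a `V`-path, so a closed path stays in one level set, where the
height strictly drops. -/
theorem isDiscreteGradient (h : IsLevelwisePerfect g X V) : IsDiscreteGradient X V := by
  refine ⟨h.isDiscreteVectorField, ?_⟩
  choose T hT using fun u => (h.isPerfectMatching u).exists_height
  have hpath : ∀ {r s}, VPath X V r s → g s = g r → T (g r) s < T (g r) r := by
    intro r s p
    induction p with
    | single hp hf hne => exact fun e => hT _ _ ⟨hp, rfl⟩ _ e hf hne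
    | @cons r t x s hp hf hne p ih =>
      intro e
      have hx : g x = g r := le_antisymm ((h.monotone _ _ hf).trans (h.grade_eq _ hp).ge)
        (e ▸ h.grade_le_of_vPath p)
      exact (hx ▸ ih (e.trans hx.symm)).trans (hT _ _ ⟨hp, rfl⟩ x hx hf hne)
  exact fun s => ⟨fun p => lt_irrefl _ (hpath p rfl)⟩

theorem isConsistent (h : IsLevelwisePerfect g X V) :
    IsConsistent V (fun u => {t | g t ≤ u}) := by
  intro p hp u
  rw [Set.mem_ofPred_eq, Set.mem_ofPred_eq, h.grade_eq p hp]

theorem isRelativePerfect (h : IsLevelwisePerfect g X V) :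
    IsRelativePerfect X V (fun u => {t | g t ≤ u}) := by
  intro q u
  have hm := h.isPerfectMatching u
  have hF : ∀ u, ∀ t ∈ {t | g t ≤ u}, ∀ s, X.IsFacet s t → s ∈ {t | g t ≤ u} :=
    fun u t ht s hst => (h.monotone s t hst).trans ht
  rw [← sublevel_sdiff_previous] at hm
  rw [← hm.ncard_critical (hF u) ?_ (previous_subset u) q, morseNumber, sublevel_sdiff_previous]
  · congr 1
    ext c
    have hu : (g c ≤ u ∧ c ∉ previous (fun u => {t | g t ≤ u}) u) ↔ g c = u :=
      Set.ext_iff.1 (sublevel_sdiff_previous u) c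
    -- Both cells of a vector have the same grade, so vectors of other grades cannot touch `c`.
    have hcrit : g c = u → (IsCritical V c ↔ IsCritical {p | p ∈ V ∧ g p.1 = u} c) := by
      intro hc
      refine ⟨fun hV p hp => hV p hp.1, fun hV p hp => ?_⟩
      by_cases hpu : g p.1 = u
      · exact hV p ⟨hp, hpu⟩
      · refine ⟨?_, ?_⟩
        · rintro rfl
          exact hpu hc
        · rintro rfl
          exact hpu ((h.grade_eq p hp).trans hc)
    constructor
    · rintro ⟨hc, hq, hcu⟩
      exact ⟨⟨hu.1 hcu, hq⟩, (hcrit (hu.1 hcu)).1 hc⟩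
    · rintro ⟨⟨hcu, hq⟩, hc⟩
      exact ⟨(hcrit hcu).2 hc, hq, hu.2 hcu⟩
  · intro t ht s hst
    obtain ⟨i, hi⟩ := Set.mem_iUnion.1 ht
    exact Set.mem_iUnion.2 ⟨i, hF _ t hi s hst⟩

/-- A target `s` outside `K^{<u}` has grade `u` or a grade not below `u`. In either case no path
reaches it from a facet of grade strictly below `u`, which is what the functional needs. -/
theorem morseRelBoundaryVanishes (h : IsLevelwisePerfect g X V) :
    MorseRelBoundaryVanishes X V (fun u => {t | g t ≤ u}) := by
  classical
  intro u t ht ht' s hs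
  have hgt : g t = u := (Set.ext_iff.1 (sublevel_sdiff_previous u) t.1).1 ⟨ht, ht'⟩
  have hgs : g s.1 ≤ u → g s.1 = u := fun h' =>
    (Set.ext_iff.1 (sublevel_sdiff_previous u) s.1).1 ⟨h', hs⟩
  rw [boundary_single, morseIncidence, sum_pathParity_separatrix h.isDiscreteGradient]
  refine (h.isPerfectMatching u).sum_pathParity (fun p hp => hp.1) h.isDiscreteGradient s.2 ?_ hgt
  intro t' (ht' : g t' = u) x (hx : g x ≠ u) hxt
  have hxu : g x ≤ u := ht' ▸ h.monotone x t' hxt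
  have hsx : ¬g s.1 ≤ g x := fun h' =>
    hx (le_antisymm hxu ((hgs (h'.trans hxu)).symm.trans_le h'))
  have : IsEmpty (VPath X V x s.1) := ⟨fun p => hsx (h.grade_le_of_vPath p)⟩
  rw [pathParity, if_neg fun e => hsx (by rw [e]), Nat.card_of_isEmpty, Nat.cast_zero, add_zero]

end IsLevelwisePerfect

end Levelwise

/-! ### Lower stars of primary simplices -/

section LowerStars

variable {ι : Type*} {K : AbstractSimplicialComplex ι} {n : ℕ} {f : ι → Fin n → ℤ}

theorem extend_mono {s t : Simplex K} (h : s.1 ⊆ t.1) : extend K f s ≤ extend K f t :=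
  fun _ => Finset.sup'_mono _ h _

theorem mem_lowerStar_self (s : Simplex K) : s ∈ lowerStar K f s :=
  ⟨Finset.Subset.refl _, le_rfl⟩

theorem IsPrimary.lowerStar_eq {s : Simplex K} (hs : IsPrimary K f s) :
    lowerStar K f s = {t | extend K f t = extend K f s} := by
  obtain ⟨u, hu⟩ := hs
  have : extend K f s = u := (Set.ext_iff.1 hu s).1 (mem_lowerStar_self s)
  rw [this, hu]

/-- Each simplex lies in the lower star of the other, so each contains the other. -/
theorem IsPrimary.eq_of_extend_eq {s s' : Simplex K} (hs : IsPrimary K f s)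
    (hs' : IsPrimary K f s') (h : extend K f s = extend K f s') : s = s' := by
  have h1 : s' ∈ lowerStar K f s := by
    rw [hs.lowerStar_eq]
    exact h.symm
  have h2 : s ∈ lowerStar K f s' := by
    rw [hs'.lowerStar_eq]
    exact h
  exact Subtype.ext (h1.1.antisymm h2.1)

/-- Every nonempty level set is the lower star of a primary simplex. -/
theorem exists_isPrimary (hn : 1 ≤ n) (hf : ∀ i : Fin n, Function.Injective (fun v => f v i))
    (t : Simplex K) : ∃ s, IsPrimary K f s ∧ extend K f s = extend K f t := by
  classical
  have hmax : ∀ (t : Simplex K) i, ∃ v ∈ t.1, f v i = extend K f t i := fun t i => by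
    obtain ⟨v, hv, h⟩ := Finset.exists_mem_eq_sup' t.nonempty (fun v => f v i)
    exact ⟨v, hv, h.symm⟩
  -- These are the vertices attaining the maximum in some coordinate; `n ≥ 1` makes the set
  -- nonempty. By injectivity of `f i`, any simplex of the same grade attains it at the same vertex,
  -- hence contains `S`.
  let S : Finset ι := t.1.filter fun v => ∃ i, f v i = extend K f t i
  have hSmem : ∀ i, ∃ v ∈ S, f v i = extend K f t i := fun i => by
    obtain ⟨v, hv, h⟩ := hmax t i
    exact ⟨v, Finset.mem_filter.2 ⟨hv, i, h⟩, h⟩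
  have hS : S.Nonempty := by
    obtain ⟨v, hv, -⟩ := hSmem ⟨0, hn⟩
    exact ⟨v, hv⟩
  let s : Simplex K := ⟨S, (K.isRelLowerSet_faces t.2).2 (Finset.filter_subset _ _) hS⟩
  have hst : extend K f s = extend K f t := by
    refine le_antisymm (extend_mono (Finset.filter_subset _ _)) fun i => ?_
    obtain ⟨v, hv, h⟩ := hSmem i
    rw [← h]
    exact Finset.le_sup' (fun v => f v i) hv
  refine ⟨s, ⟨extend K f t, ?_⟩, hst⟩
  ext t'
  constructor
  · rintro ⟨h1, h2⟩
    exact le_antisymm (h2.trans hst.le) (hst.ge.trans (extend_mono h1))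
  · intro (h : extend K f t' = extend K f t)
    refine ⟨fun v hv => ?_, (h.trans hst.symm).le⟩
    obtain ⟨-, i, hi⟩ := Finset.mem_filter.1 hv
    obtain ⟨w, hw, hwi⟩ := hmax t' i
    have : w = v := hf i (hwi.trans ((congrFun h i).trans hi.symm))
    exact this ▸ hw

variable [Finite ι]

/-- Dimension at most two enters here: a simplex strictly above `s` that is not a cofacet has
exactly two extra vertices, hence exactly two facets containing `s`, and both are in the lower star
by monotonicity. -/
theorem isShortStar_lowerStar (hK : ∀ s ∈ K.faces, s.card ≤ 3) (s : Simplex K) :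
    IsShortStar (simplicialCellComplex K) (lowerStar K f s) s := by
  classical
  refine ⟨mem_lowerStar_self s, ?_, ?_, ?_⟩
  · intro l hl hls
    rw [simplicialCellComplex_isFacet_iff] at hls
    have := Finset.card_le_card hl.1
    omega
  · intro a hsa l hl hla
    rw [simplicialCellComplex_isFacet_iff] at hsa hla
    exact (Subtype.ext (Finset.eq_of_subset_of_card_le hl.1 (by omega))).symm
  · intro a ha has hsa
    rw [simplicialCellComplex_isFacet_iff] at hsa
    have hcard : (a.1 \ s.1).card = 2 := by
      have h1 := hK a.1 a.2
      have h2 := s.nonempty.card_pos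
      have h3 := Finset.card_sdiff_add_card_eq_card ha.1
      have h4 : (a.1 \ s.1).card ≠ 0 := by
        rw [Ne, Finset.card_eq_zero, Finset.sdiff_eq_empty_iff_subset]
        exact fun h => has (Subtype.ext (h.antisymm ha.1))
      have h5 : (a.1 \ s.1).card ≠ 1 := fun h => hsa ⟨ha.1, by omega⟩
      omega
    obtain ⟨v, w, hvw, hd⟩ := Finset.card_eq_two.1 hcard
    have hv : v ∈ a.1 \ s.1 := hd ▸ Finset.mem_insert_self _ _
    have hw : w ∈ a.1 \ s.1 := hd ▸ Finset.mem_insert_of_mem (Finset.mem_singleton_self _)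
    have hacard : a.1.card = s.1.card + 2 := by
      have := Finset.card_sdiff_add_card_eq_card ha.1
      omega
    have hface : ∀ v ∈ a.1 \ s.1, insert v s.1 ∈ K.faces := fun v hv =>
      (K.isRelLowerSet_faces a.2).2 (Finset.insert_subset (Finset.mem_sdiff.1 hv).1 ha.1)
        (Finset.insert_nonempty _ _)
    have hmem : ∀ (v) (hv : v ∈ a.1 \ s.1), (⟨insert v s.1, hface v hv⟩ : Simplex K) ∈
        lowerStar K f s ∧ (simplicialCellComplex K).IsFacet s ⟨insert v s.1, hface v hv⟩ ∧
        (simplicialCellComplex K).IsFacet ⟨insert v s.1, hface v hv⟩ a := by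
      intro v hv
      have hsub := Finset.insert_subset (Finset.mem_sdiff.1 hv).1 ha.1
      have hc := Finset.card_insert_of_notMem (Finset.mem_sdiff.1 hv).2
      rw [simplicialCellComplex_isFacet_iff, simplicialCellComplex_isFacet_iff]
      exact ⟨⟨Finset.subset_insert _ _, (extend_mono hsub).trans ha.2⟩,
        ⟨Finset.subset_insert _ _, hc⟩, hsub, by
          change a.1.card = (insert v s.1).card + 1
          omega⟩
    obtain ⟨v1, v2, v3⟩ := hmem v hv
    obtain ⟨w1, w2, w3⟩ := hmem w hw
    refine ⟨_, _, v1, w1, ?_, v2, w2, v3, w3, ?_⟩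
    · intro e
      have e' : insert v s.1 = insert w s.1 := congrArg Subtype.val e
      have : v ∈ insert w s.1 := e' ▸ Finset.mem_insert_self v s.1
      rcases Finset.mem_insert.1 this with h | h
      · exact hvw h
      · exact (Finset.mem_sdiff.1 hv).2 h
    · intro l hl hla
      rw [simplicialCellComplex_isFacet_iff] at hla
      have hlcard : (l.1 \ s.1).card = 1 := by
        have := Finset.card_sdiff_add_card_eq_card hl.1
        omega
      obtain ⟨z, hz⟩ := Finset.card_eq_one.1 hlcard
      have hlz : l.1 = insert z s.1 := by
        rw [← Finset.sdiff_union_of_subset hl.1, hz]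
        rfl
      have hza : z ∈ a.1 \ s.1 :=
        Finset.sdiff_subset_sdiff hla.1 (Finset.Subset.refl _) (hz ▸ Finset.mem_singleton_self z)
      rw [hd, Finset.mem_insert, Finset.mem_singleton] at hza
      rcases hza with rfl | rfl
      · exact Or.inl (Subtype.ext hlz)
      · exact Or.inr (Subtype.ext hlz)

theorem exists_isIndexing {α : Type*} [Fintype α] (X : CellComplex α) (L : Set α) :
    ∃ I : α → ℕ, IsIndexing X L I := by
  let e := Fintype.equivFin α
  -- Order by dimension first, then by an arbitrary enumeration, which is recovered modulo the
  -- number of cells.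
  refine ⟨fun a => X.dim a * Fintype.card α + e a, ?_, ?_⟩
  · intro a _ b _ h
    have h' := congrArg (· % Fintype.card α) h
    simp only [Nat.mul_add_mod'] at h'
    rw [Nat.mod_eq_of_lt (e a).2, Nat.mod_eq_of_lt (e b).2] at h'
    exact e.injective (Fin.ext h')
  · intro a _ b _ hab
    have h1 := (e a).2
    change X.dim a * _ + _ < X.dim b * _ + _
    rw [X.dim_eq b a hab, add_mul, one_mul]
    omega

theorem exists_isHomotopyExpansionField (hK : ∀ s ∈ K.faces, s.card ≤ 3) :
    ∃ V, IsHomotopyExpansionField K f V := by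
  choose I hI using fun s : Simplex K =>
    exists_isIndexing (simplicialCellComplex K) (lowerStar K f s)
  choose W M hWM using fun s : Simplex K =>
    exists_homotopyExpansion (isShortStar_lowerStar (f := f) hK s) (I s)
  exact ⟨_, I, W, M, fun s _ => ⟨hI s, hWM s⟩, rfl⟩

/-- A nonempty level set belongs to exactly one primary simplex, so the vectors of that grade are
the output of a single run. -/
theorem IsHomotopyExpansionField.isLevelwisePerfect (hK : ∀ s ∈ K.faces, s.card ≤ 3)
    (hn : 1 ≤ n) (hf : ∀ i : Fin n, Function.Injective (fun v => f v i))
    {V : Set (Simplex K × Simplex K)} (hV : IsHomotopyExpansionField K f V) :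
    IsLevelwisePerfect (extend K f) (simplicialCellComplex K) V := by
  obtain ⟨I, W, M, hW, rfl⟩ := hV
  have hmatch : ∀ s, IsPrimary K f s →
      IsPerfectMatching (simplicialCellComplex K) {t | extend K f t = extend K f s} (W s) := by
    intro s hs
    rw [← hs.lowerStar_eq]
    exact (hW s hs).2.isPerfectMatching (isShortStar_lowerStar hK s)
  have hmem : ∀ p, p ∈ ⋃ s ∈ {s | IsPrimary K f s}, W s ↔ ∃ s, IsPrimary K f s ∧ p ∈ W s := by
    intro p
    simp
  refine ⟨?_, ?_, ?_⟩
  · intro s t hst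
    exact extend_mono ((simplicialCellComplex_isFacet_iff K s t).1 hst).1
  · intro p hp
    obtain ⟨s, hs, hps⟩ := (hmem p).1 hp
    exact ((hmatch s hs).tail_mem p hps).trans ((hmatch s hs).head_mem p hps).symm
  · intro u
    by_cases hu : ∃ t, extend K f t = u
    · obtain ⟨t, ht⟩ := hu
      obtain ⟨s, hs, hst⟩ := exists_isPrimary hn hf t
      have hsu := hst.trans ht
      have : {p | p ∈ ⋃ s ∈ {s | IsPrimary K f s}, W s ∧ extend K f p.1 = u} = W s := by
        ext p
        rw [Set.mem_ofPred_eq, hmem]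
        constructor
        · rintro ⟨⟨s', hs', hp⟩, hpu⟩
          have hs's : extend K f p.1 = extend K f s' := (hmatch s' hs').tail_mem p hp
          rwa [hs.eq_of_extend_eq hs' (by rw [hsu, ← hpu, hs's])]
        · intro hp
          have : extend K f p.1 = extend K f s := (hmatch s hs).tail_mem p hp
          exact ⟨⟨s, hs, hp⟩, this.trans hsu⟩
      rw [this, ← hsu]
      exact hmatch s hs
    · push Not at hu
      have h1 : {t | extend K f t = u} = ∅ := Set.eq_empty_of_forall_notMem hu
      have h2 : {p | p ∈ ⋃ s ∈ {s | IsPrimary K f s}, W s ∧ extend K f p.1 = u} = ∅ :=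
        Set.eq_empty_of_forall_notMem fun p hp => hu p.1 hp.2
      rw [h1, h2]
      exact .empty _

end LowerStars

end MultiMorse

end

theorem theorem5p1 {ι : Type*} [Finite ι] (K : AbstractSimplicialComplex ι)
    (hK : ∀ s ∈ K.faces, s.card ≤ 3) (n : ℕ) (hn : 1 ≤ n) (f : ι → Fin n → ℤ)
    (hf : ∀ i : Fin n, Function.Injective (fun v => f v i)) :
    (∃ V : Set (MultiMorse.Simplex K × MultiMorse.Simplex K),
      MultiMorse.IsHomotopyExpansionField K f V) ∧
    ∀ V : Set (MultiMorse.Simplex K × MultiMorse.Simplex K),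
      MultiMorse.IsHomotopyExpansionField K f V →
        MultiMorse.IsDiscreteGradient (MultiMorse.simplicialCellComplex K) V ∧
        MultiMorse.IsConsistent V (MultiMorse.sublevel K f) ∧
        MultiMorse.IsRelativePerfect (MultiMorse.simplicialCellComplex K) V
          (MultiMorse.sublevel K f) ∧
        MultiMorse.MorseRelBoundaryVanishes (MultiMorse.simplicialCellComplex K) V
          (MultiMorse.sublevel K f) := by
  refine ⟨MultiMorse.exists_isHomotopyExpansionField hK, fun V hV => ?_⟩
  have h := hV.isLevelwisePerfect hK hn hf
  exact ⟨h.isDiscreteGradient, h.isConsistent, h.isRelativePerfect, h.morseRelBoundaryVanishes⟩
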